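/- \textbf{Corollary (violation probability and density of the peak age of information in the multi-source M/M/1/1 preemptive system).} Consider $N\ge 1$ sources and one server without buffer. Source $j\in\{1,\dots,N\}$ generates updates according to a Poisson process of rate $\lambda_j>0$ started at time $0$ with the system empty. Every update carries a service time that is exponentially distributed with rate $\mu>0$. The $N$ Poisson processes and all service times are mutually independent. Every update enters service at the moment it arrives; if an update of any source arrives during its service, the update in service is discarded and the new one is served instead. An update whose service is completed is successfully received by the monitor. Let $\lambda=\sum_{j=1}^N\lambda_j$. Fix a source $i$. For $k\ge 1$ let $t_{i,k}$ and $t'_{i,k}$ be the arrival and departure moments of the $k$-th successfully received update of source $i$, and let $$T_{i,k}=t'_{i,k}-t_{i,k},\qquad Y_{i,k+1}=t'_{i,k+1}-t'_{i,k},\qquad \Delta^{\mathrm P}_{i,k}=Y_{i,k+1}+T_{i,k}$$ be its system time, the following inter-departure time, and its peak age of information (PAoI). Let $a_i$ and $b_i$ be the two roots of $s^2+(\lambda+\mu)s+\lambda_i\mu=0$, and assume $a_i\neq b_i$ (the roots are always real, and they coincide only if $N=1$ and $\lambda=\mu$). Then almost surely infinitely many updates of source $i$ are successfully received, and for every $k\ge1$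 the following hold. (1) For every threshold $p_i>0$, the violation probability of the PAoI is $$P_i^{\mathrm P}(p_i)=\Pr\{\Delta^{\mathrm P}_{i,k}>p_i\}=e^{-(\lambda+\mu)p_i}+\frac{\lambda+\mu}{a_i-b_i}\left(e^{a_ip_i}-e^{b_ip_i}\right).$$ (2) The PAoI $\Delta^{\mathrm P}_{i,k}$ has the probability density function $$f_{\Delta_i^{\mathrm P}}(x)=\begin{cases}(\lambda+\mu)\left(e^{-(\lambda+\mu)x}+\dfrac{b_ie^{b_ix}-a_ie^{a_ix}}{a_i-b_i}\right),&x\ge0,\\[1ex]0,&x<0.\end{cases}$$ (3) The inter-departure time $Y_{i,k+1}$ has the probability density function $$f_{Y_i}(x)=\begin{cases}\dfrac{\lambda_i\mu}{a_i-b_i}\left(e^{a_ix}-e^{b_ix}\right),&x\ge0,\\[1ex]0,&x<0.\end{cases}$$ -/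

import Mathlib

open MeasureTheory ProbabilityTheory

noncomputable section

namespace PreemptiveQueue

variable {Ω : Type*} {N : ℕ}

/-- Arrival time of the `n`-th update (counted from `0`) generated by source `i`, where `X i m` are
the inter-arrival times of source `i` (the process is started at time `0`). -/
def arrival (X : Fin N → ℕ → Ω → ℝ) (i : Fin N) (n : ℕ) (ω : Ω) : ℝ :=
  ∑ m ∈ Finset.range (n + 1), X i m ω

/-- The `n`-th update of source `i` is successfully received: no update of any source arrives
while it is in service. Under bufferless preemption every update enters service at its
arrival, and it is discarded at the next arrival if its service is not finished by then. -/
def Received (X S : Fin N → ℕ → Ω → ℝ) (i : Fin N) (n : ℕ) (ω : Ω) : Prop :=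
  ∀ (j : Fin N) (m : ℕ),
    ¬ (arrival X i n ω < arrival X j m ω ∧ arrival X j m ω < arrival X i n ω + S i n ω)

/-- Index, among all updates of source `i`, of its `k`-th (from `0`) successfully received one. -/
def receivedIndex (X S : Fin N → ℕ → Ω → ℝ) (i : Fin N) (k : ℕ) (ω : Ω) : ℕ :=
  Nat.nth (fun n => Received X S i n ω) k

/-- Arrival moment of the `k`-th successfully received update of source `i`. -/
def receivedArrival (X S : Fin N → ℕ → Ω → ℝ) (i : Fin N) (k : ℕ) (ω : Ω) : ℝ :=
  arrival X i (receivedIndex X S i k ω) ω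

/-- Departure moment of the `k`-th successfully received update of source `i`. -/
def departure (X S : Fin N → ℕ → Ω → ℝ) (i : Fin N) (k : ℕ) (ω : Ω) : ℝ :=
  receivedArrival X S i k ω + S i (receivedIndex X S i k ω) ω

/-- System time of the `k`-th successfully received update of source `i`. -/
def systemTime (X S : Fin N → ℕ → Ω → ℝ) (i : Fin N) (k : ℕ) (ω : Ω) : ℝ :=
  departure X S i k ω - receivedArrival X S i k ω

/-- Inter-departure time between the `k`-th and the `(k+1)`-th successfully received updates of
source `i`. -/
def interDeparture (X S : Fin N → ℕ → Ω → ℝ) (i : Fin N) (k : ℕ) (ω : Ω) : ℝ :=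
  departure X S i (k + 1) ω - departure X S i k ω

/-- Peak age of information of the `k`-th successfully received update of source `i`: the time from
its arrival until it is replaced at the monitor by the next received update of source `i`. -/
def peakAge (X S : Fin N → ℕ → Ω → ℝ) (i : Fin N) (k : ℕ) (ω : Ω) : ℝ :=
  interDeparture X S i k ω + systemTime X S i k ω

/-- Violation probability of the peak age: the probability that the peak age of the `k`-th
successfully received update of source `i` exceeds the threshold `p`. -/
def peakAgeViolation [MeasurableSpace Ω] (P : Measure Ω) (X S : Fin N → ℕ → Ω → ℝ)
    (i : Fin N) (k : ℕ) (p : ℝ) : ℝ :=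
  P.real {ω | p < peakAge X S i k ω}

/-- Stochastic primitives of the multi-source M/M/1/1 system: source `i` generates updates according
to a Poisson process of rate `lam i` (i.i.d. exponential inter-arrival times `X i n`), its `n`-th
update brings an exponential service time `S i n` of rate `mu`, and all these variables are
mutually independent. -/
structure IsMM11 [MeasurableSpace Ω] (P : Measure Ω) (lam : Fin N → ℝ) (mu : ℝ)
    (X S : Fin N → ℕ → Ω → ℝ) : Prop where
  measurable_interArrival : ∀ i n, Measurable (X i n)
  measurable_service : ∀ i n, Measurable (S i n)
  law_interArrival : ∀ i n, HasLaw (X i n) (expMeasure (lam i)) P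
  law_service : ∀ i n, HasLaw (S i n) (expMeasure mu) P
  indep : iIndepFun
    (Sum.elim (fun q : Fin N × ℕ => X q.1 q.2) (fun q : Fin N × ℕ => S q.1 q.2)) P

/-- `f` is a probability density function of the real random variable `Z`. -/
def IsDensityOf [MeasurableSpace Ω] (P : Measure Ω) (Z : Ω → ℝ) (f : ℝ → ℝ) : Prop :=
  Measurable f ∧ (∀ x, 0 ≤ f x) ∧ HasLaw Z (volume.withDensity fun x => ENNReal.ofReal (f x)) P

end PreemptiveQueue

end

/-!
The proof rests on the absence of memory of the exponential law, in the form of a regeneration of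
the whole system. Put all inter-arrival and service times on one product space. Given that a set of
sources is silent until time `t`, the system seen from time `t` has the original law
(`primitiveLaw_restrict`). Hence the system regenerates at the first arrival
(`primitiveLaw_eq_sum`): this arrival comes after an exponential time of rate `λ = ∑ j, lam j`,
belongs to source `j` with probability `lam j / λ`, brings an exponential service time, and what
follows it is a copy of the original system, independent of all this. In particular no superposition
of Poisson processes has to be constructed.

Along each sample path, a first update of another source, or one of source `i` whose service is
interrupted, does not affect the received updates of source `i`; an uninterrupted one becomes the
first of them and shifts the numbering of the others by one. For an observable `F` that acquires the
phase `exp (iθt)` when all arrivals are postponed by `t`, regeneration therefore turns into a linear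
equation for the expectation of `F` (`renewal`, `renewal_phase`). It has three uses.

* The probability that at least `k` updates are received does not depend on `k`, hence is one
  (`ae_infinite_received`).
* The characteristic function of the first departure time is
  `lam i * μ / ((a + it) * (b + it))` (`integral_departure_zero`).
* The joint law of the system time and the next inter-departure time is the same for all `k`, and
  for the first received update these times are independent, the former being exponential of rate
  `λ + μ` and the latter distributed as the first departure time (`integral_system_interDeparture`).

Since a finite measure is determined by its characteristic function, it remains to compute the
Fourier transforms of the two densities. Their nonnegativity comes from monotonicity and convexity
of the exponential function, and the violation probability is the tail integral of the density of
the peak age.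
-/

namespace PreemptiveQueue

/-! ### Infinite product measures -/

/-- Prepending an independent coordinate: if `σ` maps the index set bijectively onto the complement
of `q₀` and preserves the marginals, then a product-distributed point `y`, reindexed along `σ`,
together with an independent value at `q₀`, is again product-distributed. -/
theorem map_prepend_infinitePi {ι : Type*} (m : ι → Measure ℝ)
    [∀ q, IsProbabilityMeasure (m q)] (q₀ : ι) (σ : ι → ι) (hσ : Function.Injective σ)
    (hq : ∀ q, q ≠ q₀ ↔ q ∈ Set.range σ) (hm : ∀ q, m (σ q) = m q)
    (f : ℝ × (ι → ℝ) → (ι → ℝ)) (h0 : ∀ p, f p q₀ = p.1) (h1 : ∀ p q, f p (σ q) = p.2 q) :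
    Measurable f ∧ ((m q₀).prod (Measure.infinitePi m)).map f = Measure.infinitePi m := by
  classical
  have hf : Measurable f := by
    refine measurable_pi_iff.2 fun q => ?_
    by_cases h : q = q₀
    · subst h; simpa only [h0] using measurable_fst
    · obtain ⟨q', rfl⟩ := (hq q).1 h
      simp only [h1]; fun_prop
  refine ⟨hf, Measure.eq_infinitePi _ fun s T hT => ?_⟩
  rw [Measure.map_apply hf (.pi s.countable_toSet fun _ _ => hT _)]
  have hpre : f ⁻¹' (Set.pi s T) =
      (if q₀ ∈ s then T q₀ else Set.univ) ×ˢ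
        (Set.pi (s.preimage σ hσ.injOn) fun q => T (σ q)) := by
    ext p
    simp only [Set.mem_preimage, Set.mem_pi, Finset.mem_coe, Set.mem_prod, Finset.mem_preimage]
    constructor
    · intro h
      refine ⟨?_, fun q hqs => by simpa [h1] using h _ hqs⟩
      split_ifs with hs
      · simpa [h0] using h _ hs
      · trivial
    · rintro ⟨ha, hb⟩ q hqs
      by_cases h : q = q₀
      · subst h; simpa [h0, hqs] using ha
      · obtain ⟨q', rfl⟩ := (hq q).1 h
        simpa [h1] using hb q' hqs
  rw [hpre, Measure.prod_prod, Measure.infinitePi_pi _ (fun q _ => hT _)]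
  have hprod : ∏ q ∈ s.preimage σ hσ.injOn, m q (T (σ q)) =
      ∏ q ∈ s, if q = q₀ then 1 else m q (T q) := by
    rw [← Finset.prod_preimage σ s hσ.injOn (fun q => if q = q₀ then 1 else m q (T q))]
    · refine Finset.prod_congr rfl fun q _ => ?_
      rw [if_neg ((hq _).2 ⟨q, rfl⟩), hm]
    · intro q _ hr
      rw [if_pos (by by_contra h; exact hr ((hq q).1 h))]
  rw [hprod]
  split_ifs with hs
  · rw [← Finset.mul_prod_erase s _ hs, ← Finset.mul_prod_erase s (fun q => m q (T q)) hs,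
      if_pos rfl, one_mul]
    congr 1
    exact Finset.prod_congr rfl fun q hqs => by rw [if_neg (Finset.ne_of_mem_erase hqs)]
  · rw [measure_univ, one_mul]
    exact Finset.prod_congr rfl fun q hqs => by rw [if_neg (by rintro rfl; exact hs hqs)]

/-- Restricting a product measure to a box acts coordinatewise: if restricting each marginal to the
corresponding side of the box amounts, up to a factor, to transporting it by a map `g q`, then the
same holds for the product measure, with the product of the factors. -/
theorem infinitePi_restrict_pi {ι : Type*} (m : ι → Measure ℝ)
    [∀ q, IsProbabilityMeasure (m q)] (L : Finset ι) (A : ι → Set ℝ) (c : ι → ENNReal)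
    (g : ι → ℝ → ℝ) (hA : ∀ q, MeasurableSet (A q)) (hg : ∀ q, Measurable (g q))
    (hc0 : ∀ q, c q ≠ 0) (hct : ∀ q, c q ≠ ⊤)
    (hAL : ∀ q ∉ L, A q = Set.univ) (hcL : ∀ q ∉ L, c q = 1)
    (h : ∀ q, (m q).restrict (A q) = c q • (m q).map (g q)) :
    (Measure.infinitePi m).restrict (Set.pi L A) =
      (∏ q ∈ L, c q) • (Measure.infinitePi m).map (fun x q => g q (x q)) := by
  classical
  have (q : ι) : IsProbabilityMeasure ((m q).map (g q)) :=
    Measure.isProbabilityMeasure_map (hg q).aemeasurable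
  have hC0 : ∏ q ∈ L, c q ≠ 0 := Finset.prod_ne_zero_iff.2 fun q _ => hc0 q
  have hCt : ∏ q ∈ L, c q ≠ ⊤ := ENNReal.prod_ne_top fun q _ => hct q
  have key : (∏ q ∈ L, c q)⁻¹ • (Measure.infinitePi m).restrict (Set.pi L A) =
      Measure.infinitePi (fun q => (m q).map (g q)) := by
    refine Measure.eq_infinitePi _ fun s T hT => ?_
    -- both boxes are extended by full sides, so that they are indexed by the same finite set
    set T' : ι → Set ℝ := fun q => if q ∈ s then T q else Set.univ with hT'
    have hT'm : ∀ q, MeasurableSet (T' q) := fun q => by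
      simp only [hT']; split_ifs
      · exact hT q
      · exact .univ
    have hset : Set.pi (s : Set ι) T ∩ Set.pi (L : Set ι) A =
        Set.pi ((s ∪ L : Finset ι) : Set ι) (fun q => T' q ∩ A q) := by
      ext x
      simp only [Set.mem_inter_iff, Set.mem_pi, Finset.mem_coe, Finset.mem_union, hT']
      constructor
      · rintro ⟨h1, h2⟩ q _
        refine ⟨?_, ?_⟩
        · split_ifs with hs
          · exact h1 q hs
          · trivial
        · by_cases hL : q ∈ L
          · exact h2 q hL
          · rw [hAL q hL]; trivial
      · intro h1
        exact ⟨fun q hs => by simpa [hs] using (h1 q (.inl hs)).1,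
          fun q hL => (h1 q (.inr hL)).2⟩
    have hfac : ∀ q, m q (T' q ∩ A q) = c q * (m q).map (g q) (T' q) := fun q => by
      rw [← Measure.restrict_apply (hT'm q), h q]; rfl
    rw [Measure.smul_apply, Measure.restrict_apply (.pi s.countable_toSet fun _ _ => hT _), hset,
      Measure.infinitePi_pi _ (fun q _ => (hT'm q).inter (hA q)), smul_eq_mul,
      Finset.prod_congr rfl (fun q _ => hfac q), Finset.prod_mul_distrib,
      ← Finset.prod_subset (Finset.subset_union_right (s₁ := s)) (fun q _ hL => hcL q hL),
      ← Finset.prod_subset (Finset.subset_union_left (s₂ := L))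
        (fun q _ hs => by simp only [hT', if_neg hs, measure_univ]),
      ← mul_assoc, ENNReal.inv_mul_cancel hC0 hCt, one_mul]
    exact Finset.prod_congr rfl fun q hs => by simp only [hT', if_pos hs]
  rw [Measure.infinitePi_map_pi m hg, ← key, smul_smul, ENNReal.mul_inv_cancel hC0 hCt, one_smul]

/-! ### The exponential distribution -/

theorem expMeasure_eq (r : ℝ) : expMeasure r = volume.withDensity (exponentialPDF r) := rfl

theorem measurable_exponentialPDF (r : ℝ) : Measurable (exponentialPDF r) :=
  (measurable_exponentialPDFReal r).ennreal_ofReal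

/-- Integration against an exponential law of a different rate. -/
theorem lintegral_expMeasure_exp_mul {r q : ℝ} (hr : 0 < r) (hrq : 0 < q) {f : ℝ → ENNReal}
    (hf : Measurable f) :
    ∫⁻ t, ENNReal.ofReal (Real.exp (-((q - r) * t))) * f t ∂expMeasure r =
      ENNReal.ofReal (r / q) * ∫⁻ t, f t ∂expMeasure q := by
  rw [expMeasure_eq, expMeasure_eq,
    lintegral_withDensity_eq_lintegral_mul _ (measurable_exponentialPDF r) (by fun_prop),
    lintegral_withDensity_eq_lintegral_mul _ (measurable_exponentialPDF q) hf,
    ← lintegral_const_mul _ ((measurable_exponentialPDF q).mul hf)]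
  refine lintegral_congr fun t => ?_
  simp only [Pi.mul_apply, exponentialPDF_eq]
  rw [← mul_assoc, ← mul_assoc, ← ENNReal.ofReal_mul (by split_ifs <;> positivity),
    ← ENNReal.ofReal_mul (by positivity)]
  split_ifs with ht
  · congr 2
    have : Real.exp (-(q * t)) = Real.exp (-(r * t)) * Real.exp (-((q - r) * t)) := by
      rw [← Real.exp_add]; ring_nf
    rw [this]; field_simp
  · simp

/-- The exponential law has no memory. -/
theorem expMeasure_restrict_Ici {r t : ℝ} (ht : 0 ≤ t) :
    (expMeasure r).restrict (Set.Ici t) =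
      ENNReal.ofReal (Real.exp (-(r * t))) • (expMeasure r).map (fun x => x + t) := by
  ext s hs
  have hsh : Measurable fun x : ℝ => x + t := by fun_prop
  rw [Measure.restrict_apply hs, Measure.smul_apply, Measure.map_apply hsh hs, expMeasure_eq,
    withDensity_apply _ (hs.inter measurableSet_Ici), withDensity_apply _ (hsh hs), smul_eq_mul,
    ← lintegral_indicator (hs.inter measurableSet_Ici), ← lintegral_indicator (hsh hs),
    ← lintegral_const_mul _ ((measurable_exponentialPDF r).indicator (hsh hs)),
    ← lintegral_add_right_eq_self (μ := volume)
      ((s ∩ Set.Ici t).indicator fun x => exponentialPDF r x) t]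
  refine lintegral_congr fun x => ?_
  by_cases hx : x + t ∈ s
  · rw [Set.indicator_of_mem (s := (fun x => x + t) ⁻¹' s) hx]
    by_cases h0 : 0 ≤ x
    · rw [Set.indicator_of_mem (s := s ∩ Set.Ici t) ⟨hx, by simpa using h0⟩,
        exponentialPDF_eq, exponentialPDF_eq,
        if_pos h0, if_pos (by positivity), ← ENNReal.ofReal_mul (by positivity)]
      congr 1
      rw [mul_left_comm, ← Real.exp_add]; ring_nf
    · rw [Set.indicator_of_notMem (by simp [h0]), exponentialPDF_of_neg (not_le.1 h0), mul_zero]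
  · rw [Set.indicator_of_notMem (fun h => hx h.1),
      Set.indicator_of_notMem (s := (fun x => x + t) ⁻¹' s) hx, mul_zero]

theorem ae_pos_expMeasure (r : ℝ) : ∀ᵐ t ∂expMeasure r, 0 < t := by
  have h : expMeasure r (Set.Iic 0) = 0 := by
    rw [expMeasure_eq, withDensity_apply _ measurableSet_Iic,
      setLIntegral_congr (Iio_ae_eq_Iic (a := (0 : ℝ))).symm]
    exact lintegral_exponentialPDF_of_nonpos le_rfl
  rw [ae_iff]; simpa [Set.Iic] using h

/-! ### The canonical space of primitives and its regeneration -/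

/-- Canonical sample space: the left summand holds the inter-arrival times and the right summand the
service times, both indexed by the source and the number of the update. -/
abbrev Primitives (N : ℕ) : Type := (Fin N × ℕ) ⊕ (Fin N × ℕ) → ℝ

/-- Inter-arrival times on the canonical space. -/
def interArrivalOf {N : ℕ} (i : Fin N) (n : ℕ) (z : Primitives N) : ℝ := z (.inl (i, n))

/-- Service times on the canonical space. -/
def serviceOf {N : ℕ} (i : Fin N) (n : ℕ) (z : Primitives N) : ℝ := z (.inr (i, n))

/-- Marginal laws of the primitives. -/
noncomputable def marginal {N : ℕ} (lam : Fin N → ℝ) (mu : ℝ) :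
    (Fin N × ℕ) ⊕ (Fin N × ℕ) → Measure ℝ :=
  Sum.elim (fun q => expMeasure (lam q.1)) (fun _ => expMeasure mu)

/-- Joint law of the primitives. -/
noncomputable def primitiveLaw {N : ℕ} (lam : Fin N → ℝ) (mu : ℝ) : Measure (Primitives N) :=
  Measure.infinitePi (marginal lam mu)

/-- Postpone the arrivals of the sources in `L` by `t`. -/
noncomputable def delay {N : ℕ} (L : Finset (Fin N)) (t : ℝ) (z : Primitives N) : Primitives N :=
  Sum.elim (fun q => if q.1 ∈ L ∧ q.2 = 0 then z (.inl q) + t else z (.inl q)) (fun q => z (.inr q))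

/-- Put `t` in front of the inter-arrival times of source `j`. -/
noncomputable def prependArrival {N : ℕ} (j : Fin N) (p : ℝ × Primitives N) : Primitives N :=
  Sum.elim
    (fun q => if q.1 = j then (if q.2 = 0 then p.1 else p.2 (.inl (j, q.2 - 1))) else p.2 (.inl q))
    (fun q => p.2 (.inr q))

/-- Put `s` in front of the service times of source `j`. -/
noncomputable def prependService {N : ℕ} (j : Fin N) (p : ℝ × Primitives N) : Primitives N :=
  Sum.elim (fun q => p.2 (.inl q))
    (fun q => if q.1 = j then (if q.2 = 0 then p.1 else p.2 (.inr (j, q.2 - 1))) else p.2 (.inr q))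

/-- The system in which source `j` first sends an update at time `t` with service time `s`, its
later primitives and those of the other sources being given by `z`. Other sources are not
delayed. -/
noncomputable def prepend {N : ℕ} (j : Fin N) (p : ℝ × ℝ × Primitives N) : Primitives N :=
  prependArrival j (p.1, prependService j p.2)

/-- No source sends an update before time `s`. An arrival at time `s` itself is allowed: it does not
interrupt a service ending at `s`. -/
def Clear {N : ℕ} (s : ℝ) (z : Primitives N) : Prop := ∀ l : Fin N, s ≤ z (.inl (l, 0))

section law

variable {N : ℕ} {lam : Fin N → ℝ} {mu : ℝ}

theorem isProbabilityMeasure_marginal (hlam : ∀ j, 0 < lam j) (hmu : 0 < mu)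
    (q : (Fin N × ℕ) ⊕ (Fin N × ℕ)) : IsProbabilityMeasure (marginal lam mu q) := by
  rcases q with q | q
  · exact isProbabilityMeasure_expMeasure (hlam q.1)
  · exact isProbabilityMeasure_expMeasure hmu

theorem isProbabilityMeasure_primitiveLaw (hlam : ∀ j, 0 < lam j) (hmu : 0 < mu) :
    IsProbabilityMeasure (primitiveLaw lam mu) := by
  have := isProbabilityMeasure_marginal hlam hmu
  unfold primitiveLaw; infer_instance

theorem injective_bump (j : Fin N) :
    Function.Injective fun q : Fin N × ℕ => if q.1 = j then (j, q.2 + 1) else q := by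
  rintro ⟨a, m⟩ ⟨b, n⟩ h
  dsimp only at h
  split_ifs at h with h1 h2 h2 <;> simp_all

theorem ne_iff_mem_range_bump (j : Fin N) (q : Fin N × ℕ) :
    q ≠ (j, 0) ↔ ∃ p : Fin N × ℕ, (if p.1 = j then (j, p.2 + 1) else p) = q := by
  rcases q with ⟨a, m⟩
  constructor
  · intro h
    by_cases ha : a = j
    · subst ha
      rcases m with _ | m
      · exact absurd rfl h
      · exact ⟨(a, m), by simp⟩
    · exact ⟨(a, m), by simp [ha]⟩
  · rintro ⟨p, hp⟩ h
    rw [h] at hp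
    split_ifs at hp with h1
    · simp at hp
    · exact h1 (by rw [hp])

theorem measurePreserving_prependArrival (hlam : ∀ j, 0 < lam j) (hmu : 0 < mu) (j : Fin N) :
    MeasurePreserving (prependArrival j) ((expMeasure (lam j)).prod (primitiveLaw lam mu))
      (primitiveLaw lam mu) := by
  have := isProbabilityMeasure_marginal hlam hmu
  have h := map_prepend_infinitePi (marginal lam mu) (.inl (j, 0))
    (Sum.map (fun q : Fin N × ℕ => if q.1 = j then (j, q.2 + 1) else q) id)
    ((injective_bump j).sumMap Function.injective_id) ?_ ?_ (prependArrival j) ?_ ?_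
  · exact ⟨h.1, h.2⟩
  · rintro (q | q)
    · simpa using ne_iff_mem_range_bump j q
    · simp
  · rintro (q | q)
    · simp only [marginal, Sum.map_inl, Sum.elim_inl]; split_ifs with h <;> simp [h]
    · rfl
  · intro p; simp [prependArrival]
  · rintro p (⟨a, m⟩ | q)
    · by_cases h : a = j <;> simp [prependArrival, h]
    · rfl

theorem measurePreserving_prependService (hlam : ∀ j, 0 < lam j) (hmu : 0 < mu) (j : Fin N) :
    MeasurePreserving (prependService j) ((expMeasure mu).prod (primitiveLaw lam mu))
      (primitiveLaw lam mu) := by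
  have := isProbabilityMeasure_marginal hlam hmu
  have h := map_prepend_infinitePi (marginal lam mu) (.inr (j, 0))
    (Sum.map id (fun q : Fin N × ℕ => if q.1 = j then (j, q.2 + 1) else q))
    (Function.injective_id.sumMap (injective_bump j)) ?_ ?_ (prependService j) ?_ ?_
  · exact ⟨h.1, h.2⟩
  · rintro (q | q)
    · simp
    · simpa using ne_iff_mem_range_bump j q
  · rintro (q | q) <;> rfl
  · intro p; simp [prependService]
  · rintro p (q | ⟨a, m⟩)
    · rfl
    · by_cases h : a = j <;> simp [prependService, h]

theorem measurePreserving_prepend (hlam : ∀ j, 0 < lam j) (hmu : 0 < mu) (j : Fin N) :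
    MeasurePreserving (prepend j)
      ((expMeasure (lam j)).prod ((expMeasure mu).prod (primitiveLaw lam mu)))
      (primitiveLaw lam mu) := by
  have := isProbabilityMeasure_primitiveLaw hlam hmu
  have := isProbabilityMeasure_expMeasure (hlam j)
  have := isProbabilityMeasure_expMeasure hmu
  exact (measurePreserving_prependArrival hlam hmu j).comp
    ((MeasurePreserving.id _).prod (measurePreserving_prependService hlam hmu j))

theorem measurable_delay (L : Finset (Fin N)) :
    Measurable fun p : ℝ × Primitives N => delay L p.1 p.2 := by
  refine measurable_pi_iff.2 ?_
  rintro (q | q)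
  · simp only [delay, Sum.elim_inl]; split_ifs <;> fun_prop
  · simp only [delay, Sum.elim_inr]; fun_prop

theorem measurable_delay_const (L : Finset (Fin N)) (t : ℝ) : Measurable (delay L t) :=
  (measurable_delay L).comp (measurable_const.prodMk measurable_id)

/-- Absence of memory for the whole system: given that the sources in `L` are silent before `t`,
their arrivals after `t` and all other primitives have the original law. -/
theorem primitiveLaw_restrict (hlam : ∀ j, 0 < lam j) (hmu : 0 < mu) (L : Finset (Fin N)) {t : ℝ}
    (ht : 0 ≤ t) :
    (primitiveLaw lam mu).restrict {z | ∀ l ∈ L, t ≤ z (.inl (l, 0))} =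
      ENNReal.ofReal (Real.exp (-((∑ l ∈ L, lam l) * t))) •
        (primitiveLaw lam mu).map (delay L t) := by
  classical
  have := isProbabilityMeasure_marginal hlam hmu
  set B : Finset ((Fin N × ℕ) ⊕ (Fin N × ℕ)) :=
    L.image fun l => .inl (l, 0) with hB
  have hmem : ∀ q, q ∈ B ↔ ∃ l ∈ L, Sum.inl (l, 0) = q := by simp [hB]
  have hmeml : ∀ q : Fin N × ℕ, Sum.inl q ∈ B ↔ q.1 ∈ L ∧ q.2 = 0 := by
    rintro ⟨a, m⟩; rw [hmem]; simp [eq_comm]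
  have hmemr : ∀ q : Fin N × ℕ, Sum.inr q ∉ B := by intro q; rw [hmem]; simp
  have h := infinitePi_restrict_pi (marginal lam mu) B
    (fun q => if q ∈ B then Set.Ici t else Set.univ)
    (Sum.elim (fun q => if Sum.inl q ∈ B then ENNReal.ofReal (Real.exp (-(lam q.1 * t))) else 1)
      fun _ => 1)
    (fun q x => if q ∈ B then x + t else x) ?_ ?_ ?_ ?_ ?_ ?_ ?_
  · have hs : {z : Primitives N | ∀ l ∈ L, t ≤ z (.inl (l, 0))} =
        Set.pi B fun q => if q ∈ B then Set.Ici t else Set.univ := by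
      ext z
      simp only [Set.mem_ofPred_eq, Set.mem_pi, Finset.mem_coe]
      constructor
      · intro hz q hq
        obtain ⟨l, hl, rfl⟩ := (hmem q).1 hq
        simpa [hq] using hz l hl
      · intro hz l hl
        have hq := (hmem (.inl (l, 0))).2 ⟨l, hl, rfl⟩
        simpa [hq] using hz _ hq
    rw [hs, primitiveLaw, h]
    congr 1
    · rw [hB, Finset.prod_image (fun a _ b _ h => by simpa using h), Finset.sum_mul,
        ← Finset.sum_neg_distrib, Real.exp_sum,
        ENNReal.ofReal_prod_of_nonneg fun _ _ => (Real.exp_pos _).le]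
      refine Finset.prod_congr rfl fun l hl => ?_
      have : (Sum.inl (l, 0) : (Fin N × ℕ) ⊕ (Fin N × ℕ)) ∈ B := (hmeml _).2 ⟨hl, rfl⟩
      simp only [Sum.elim_inl]
      rw [if_pos this]
    · congr 1
      funext z q
      rcases q with q | q
      · simp only [delay, Sum.elim_inl, hmeml]
      · simp only [delay, Sum.elim_inr, hmemr, if_false]
  · intro q; split_ifs
    · exact measurableSet_Ici
    · exact .univ
  · intro q; split_ifs <;> fun_prop
  · rintro (q | q)
    · simp only [Sum.elim_inl]; split_ifs <;> simp [Real.exp_pos]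
    · simp
  · rintro (q | q)
    · simp only [Sum.elim_inl]; split_ifs <;> simp
    · simp
  · intro q hq; simp [hq]
  · rintro (q | q) hq
    · simp [hq]
    · simp
  · rintro (q | q)
    · by_cases hq : Sum.inl q ∈ B
      · simpa [hq, marginal] using expMeasure_restrict_Ici ht
      · simp [hq]
    · simp [hmemr]

theorem prepend_delay (j : Fin N) (t s : ℝ) (z : Primitives N) :
    prepend j (t, s, delay (Finset.univ.erase j) t z) =
      delay Finset.univ t (prepend j (0, s, z)) := by
  funext q
  rcases q with ⟨a, m⟩ | ⟨a, m⟩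
  · by_cases h : a = j <;> by_cases hm : m = 0 <;>
      simp [prepend, prependArrival, prependService, delay, h, hm]
  · by_cases h : a = j <;> by_cases hm : m = 0 <;>
      simp [prepend, prependArrival, prependService, delay, h, hm]

theorem measurableSet_first (j : Fin N) :
    MeasurableSet {x : Primitives N | ∀ l, x (.inl (j, 0)) ≤ x (.inl (l, 0))} := by
  simp only [Set.ofPred_forall]
  exact .iInter fun l => measurableSet_le (measurable_pi_apply _) (measurable_pi_apply _)

theorem measurable_delay_prepend (j : Fin N) :
    Measurable fun p : ℝ × ℝ × Primitives N => delay Finset.univ p.1 (prepend j (0, p.2)) := by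
  have hp : Measurable (prepend (N := N) j) := by
    refine measurable_pi_iff.2 ?_
    rintro (q | q)
    · simp only [prepend, prependArrival, prependService, Sum.elim_inl]; split_ifs <;> fun_prop
    · simp only [prepend, prependArrival, prependService, Sum.elim_inr]; split_ifs <;> fun_prop
  exact (measurable_delay _).comp (measurable_fst.prodMk (hp.comp (by fun_prop)))

/-- On the event that source `j` is the first to send an update (ties allowed), the time until this
update is exponential with the total rate, and the update and the system after it are as in the
original system. -/
theorem primitiveLaw_restrict_first (hlam : ∀ j, 0 < lam j) (hmu : 0 < mu) (j : Fin N) :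
    (primitiveLaw lam mu).restrict {x | ∀ l, x (.inl (j, 0)) ≤ x (.inl (l, 0))} =
      ENNReal.ofReal (lam j / ∑ l, lam l) •
        ((expMeasure (∑ l, lam l)).prod ((expMeasure mu).prod (primitiveLaw lam mu))).map
          (fun p => delay Finset.univ p.1 (prepend j (0, p.2))) := by
  have hL : 0 < ∑ l, lam l := Finset.sum_pos (fun l _ => hlam l) ⟨j, Finset.mem_univ j⟩
  have := isProbabilityMeasure_primitiveLaw hlam hmu
  have := isProbabilityMeasure_expMeasure (hlam j)
  have := isProbabilityMeasure_expMeasure hmu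
  have := isProbabilityMeasure_expMeasure hL
  have hE : ∑ l ∈ Finset.univ.erase j, lam l = ∑ l, lam l - lam j :=
    Finset.sum_erase_eq_sub (Finset.mem_univ j)
  have hmp := measurePreserving_prepend hlam hmu j
  have hmd := measurable_delay_prepend (N := N) j
  ext A hA
  set B := {x : Primitives N | ∀ l, x (.inl (j, 0)) ≤ x (.inl (l, 0))} with hB
  have hBA : MeasurableSet (A ∩ B) := hA.inter (measurableSet_first j)
  -- for a given first arrival of source `j` at `t`, the other sources have to be silent until `t`
  have hsect : ∀ t : ℝ, 0 ≤ t → ∀ s : ℝ,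
      ∫⁻ z, (A ∩ B).indicator 1 (prepend j (t, s, z)) ∂primitiveLaw lam mu =
        ENNReal.ofReal (Real.exp (-((∑ l, lam l - lam j) * t))) *
          ∫⁻ z, A.indicator 1 (delay Finset.univ t (prepend j (0, s, z))) ∂primitiveLaw lam mu := by
    intro t ht s
    have hms : Measurable fun z : Primitives N => prepend j (t, s, z) :=
      hmp.measurable.comp (by fun_prop)
    set D := {z : Primitives N | ∀ l ∈ Finset.univ.erase j, t ≤ z (.inl (l, 0))} with hD
    have hset : MeasurableSet D := by
      rw [hD]
      simp only [Set.ofPred_forall]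
      exact .iInter fun l => .iInter fun _ => measurableSet_le measurable_const
        (measurable_pi_apply _)
    have hind : ∀ z, (A ∩ B).indicator (1 : Primitives N → ENNReal) (prepend j (t, s, z)) =
        D.indicator (fun z => A.indicator 1 (prepend j (t, s, z))) z := by
      intro z
      have : prepend j (t, s, z) ∈ B ↔ z ∈ D := by
        simp only [hB, hD, Set.mem_ofPred_eq, Finset.mem_erase, Finset.mem_univ, and_true]
        refine forall_congr' fun l => ?_
        by_cases h : l = j <;> simp [prepend, prependArrival, prependService, h]
      by_cases hz : prepend j (t, s, z) ∈ B
      · rw [Set.indicator_of_mem (s := D) (this.1 hz)]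
        by_cases hzA : prepend j (t, s, z) ∈ A
        · rw [Set.indicator_of_mem (s := A ∩ B) ⟨hzA, hz⟩, Set.indicator_of_mem hzA]
        · rw [Set.indicator_of_notMem (s := A ∩ B) (fun h => hzA h.1),
            Set.indicator_of_notMem hzA]
      · rw [Set.indicator_of_notMem (s := A ∩ B) (fun h => hz h.2),
          Set.indicator_of_notMem (s := D) (fun h => hz (this.2 h))]
    simp_rw [hind]
    rw [lintegral_indicator hset, hD, primitiveLaw_restrict hlam hmu _ ht,
      lintegral_smul_measure, hE,
      lintegral_map (f := fun z => A.indicator 1 (prepend j (t, s, z)))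
        ((measurable_one.indicator hA).comp hms)
        (measurable_delay_const _ t), smul_eq_mul]
    simp_rw [prepend_delay]
  rw [Measure.restrict_apply hA, Measure.smul_apply, Measure.map_apply hmd hA, smul_eq_mul,
    ← lintegral_indicator_one hBA, ← hmp.map_eq,
    lintegral_map (measurable_one.indicator hBA) hmp.measurable, hmp.map_eq,
    ← lintegral_indicator_one (hmd hA),
    lintegral_prod (fun p => (A ∩ B).indicator 1 (prepend j p))
      ((measurable_one.indicator hBA).comp hmp.measurable).aemeasurable,
    lintegral_prod _ (measurable_one.indicator (hmd hA)).aemeasurable]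
  rw [← lintegral_expMeasure_exp_mul (hlam j) hL
    (measurable_one.indicator (hmd hA)).lintegral_prod_right']
  refine lintegral_congr_ae ?_
  filter_upwards [ae_pos_expMeasure (lam j)] with t ht
  rw [lintegral_prod (fun p => (A ∩ B).indicator 1 (prepend j (t, p)))
    (((measurable_one.indicator hBA).comp hmp.measurable).comp
      measurable_prodMk_left).aemeasurable,
    lintegral_prod (fun p => (_ ⁻¹' A).indicator 1 (t, p))
      ((measurable_one.indicator (hmd hA)).comp measurable_prodMk_left).aemeasurable]
  simp only [hsect t ht.le]
  rw [lintegral_const_mul]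
  · rfl
  · exact (((measurable_one.indicator (hmd hA)).comp
      measurable_prodMk_left).lintegral_prod_right')

/-- Regeneration at the first arrival: the first update comes after an exponential time with the
total rate, belongs to source `j` with probability `lam j / ∑ l, lam l`, and what follows it is a
copy of the original system. -/
theorem primitiveLaw_eq_sum (hlam : ∀ j, 0 < lam j) (hmu : 0 < mu) (i : Fin N) :
    primitiveLaw lam mu = ∑ j, ENNReal.ofReal (lam j / ∑ l, lam l) •
      ((expMeasure (∑ l, lam l)).prod ((expMeasure mu).prod (primitiveLaw lam mu))).map
        (fun p => delay Finset.univ p.1 (prepend j (0, p.2))) := by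
  have hL : 0 < ∑ l, lam l := Finset.sum_pos (fun l _ => hlam l) ⟨i, Finset.mem_univ i⟩
  have := isProbabilityMeasure_primitiveLaw hlam hmu
  have := isProbabilityMeasure_expMeasure hmu
  have := isProbabilityMeasure_expMeasure hL
  have (j : Fin N) := Measure.isProbabilityMeasure_map
    (μ := (expMeasure (∑ l, lam l)).prod ((expMeasure mu).prod (primitiveLaw lam mu)))
    (measurable_delay_prepend (N := N) j).aemeasurable
  -- the events on the left cover the space, and the masses on the right add up to one
  have hle : primitiveLaw lam mu ≤ ∑ j, (primitiveLaw lam mu).restrict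
      {x | ∀ l, x (.inl (j, 0)) ≤ x (.inl (l, 0))} := by
    have hU : ⋃ j : Fin N, {x : Primitives N | ∀ l, x (.inl (j, 0)) ≤ x (.inl (l, 0))} =
        Set.univ := by
      refine Set.eq_univ_of_forall fun x => Set.mem_iUnion.2 ?_
      obtain ⟨j, -, hj⟩ := Finset.exists_min_image Finset.univ (fun l => x (.inl (l, 0)))
        ⟨i, Finset.mem_univ i⟩
      exact ⟨j, fun l => hj l (Finset.mem_univ l)⟩
    rw [← Measure.sum_fintype]
    conv_lhs => rw [← Measure.restrict_univ (μ := primitiveLaw lam mu), ← hU]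
    exact Measure.restrict_iUnion_le
  simp_rw [primitiveLaw_restrict_first hlam hmu] at hle
  refine Measure.eq_of_le_of_measure_univ_eq hle ?_
  rw [measure_univ, Measure.coe_finsetSum, Finset.sum_apply]
  simp only [Measure.smul_apply, measure_univ, smul_eq_mul, mul_one]
  rw [← ENNReal.ofReal_sum_of_nonneg fun l _ => (div_pos (hlam l) hL).le, ← Finset.sum_div,
    div_self hL.ne', ENNReal.ofReal_one]

theorem ae_pos_primitiveLaw (hlam : ∀ j, 0 < lam j) (hmu : 0 < mu) :
    ∀ᵐ z ∂primitiveLaw lam mu, ∀ q, 0 < z q := by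
  have := isProbabilityMeasure_marginal hlam hmu
  refine ae_all_iff.2 fun q => ?_
  have h : ∀ᵐ t ∂marginal lam mu q, 0 < t := by
    rcases q with q | q <;> exact ae_pos_expMeasure _
  exact (measurePreserving_eval_infinitePi (marginal lam mu) q).quasiMeasurePreserving.ae h

end law

/-! ### Counting and enumerating -/

theorem nth_succ_of_not {p : ℕ → Prop} (h0 : ¬ p 0) (hinf : {n | p (n + 1)}.Infinite) (k : ℕ) :
    Nat.nth p k = Nat.nth (fun n => p (n + 1)) k + 1 := by
  classical
  have h1 : p (Nat.nth (fun n => p (n + 1)) k + 1) := Nat.nth_mem_of_infinite hinf k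
  have h2 := Nat.nth_count h1
  rwa [Nat.count_succ', if_neg h0, Nat.count_nth_of_infinite hinf] at h2

theorem nth_succ_of_zero {p : ℕ → Prop} (h0 : p 0) (hinf : {n | p (n + 1)}.Infinite) (k : ℕ) :
    Nat.nth p (k + 1) = Nat.nth (fun n => p (n + 1)) k + 1 := by
  classical
  have h1 : p (Nat.nth (fun n => p (n + 1)) k + 1) := Nat.nth_mem_of_infinite hinf k
  have h2 := Nat.nth_count h1
  rwa [Nat.count_succ', if_pos h0, Nat.count_nth_of_infinite hinf] at h2

open scoped Classical in
/-- The predicate `p` holds for at least `k` natural numbers. -/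
def AtLeastTimes (p : ℕ → Prop) (k : ℕ) : Prop := ∃ n, k ≤ Nat.count p n

theorem atLeastTimes_succ_of_zero {p : ℕ → Prop} (h0 : p 0) (k : ℕ) :
    AtLeastTimes p (k + 1) ↔ AtLeastTimes (fun n => p (n + 1)) k := by
  constructor
  · rintro ⟨_ | n, hn⟩
    · simp at hn
    · rw [Nat.count_succ', if_pos h0] at hn
      exact ⟨n, Nat.le_of_succ_le_succ hn⟩
  · rintro ⟨n, hn⟩
    refine ⟨n + 1, ?_⟩
    rw [Nat.count_succ', if_pos h0]
    exact Nat.succ_le_succ hn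

theorem atLeastTimes_succ_of_not {p : ℕ → Prop} (h0 : ¬ p 0) (k : ℕ) :
    AtLeastTimes p (k + 1) ↔ AtLeastTimes (fun n => p (n + 1)) (k + 1) := by
  constructor
  · rintro ⟨_ | n, hn⟩
    · simp at hn
    · rw [Nat.count_succ', if_neg h0] at hn
      exact ⟨n, hn⟩
  · rintro ⟨n, hn⟩
    refine ⟨n + 1, ?_⟩
    rw [Nat.count_succ', if_neg h0]
    exact hn

theorem infinite_of_forall_atLeastTimes {p : ℕ → Prop} (h : ∀ k, AtLeastTimes p k) :
    {n | p n}.Infinite := by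
  classical
  intro hfin
  obtain ⟨n, hn⟩ := h (hfin.toFinset.card + 1)
  rw [Nat.count_eq_card_filter_range] at hn
  exact absurd (Finset.card_le_card fun m hm => by simpa using (Finset.mem_filter.1 hm).2)
    (not_le.2 (Nat.lt_of_succ_le hn))

theorem measurable_nth {α : Type*} [MeasurableSpace α] {p : α → ℕ → Prop}
    (hp : ∀ n, Measurable fun x => p x n) (k : ℕ) : Measurable fun x => Nat.nth (p x) k := by
  induction k using Nat.strong_induction_on with
  | _ k ih =>
    have hQ : ∀ n, Measurable fun x => p x n ∧ ∀ j < k, Nat.nth (p x) j < n := by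
      intro n
      refine (hp n).and (Measurable.forall fun j => ?_)
      by_cases hj : j < k
      · simp only [hj, true_imp_iff]
        exact measurableSet_setOfPred.1 (measurableSet_lt (ih j hj) measurable_const)
      · simp only [hj, false_imp_iff]; exact measurable_const
    refine measurable_to_countable' fun m => ?_
    have hset : (fun x => Nat.nth (p x) k) ⁻¹' {m} =
        {x | ((p x m ∧ ∀ j < k, Nat.nth (p x) j < m) ∧
            ∀ n, n < m → ¬ (p x n ∧ ∀ j < k, Nat.nth (p x) j < n)) ∨
          (m = 0 ∧ ∀ n, ¬ (p x n ∧ ∀ j < k, Nat.nth (p x) j < n))} := by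
      ext x
      simp only [Set.mem_preimage, Set.mem_singleton_iff]
      rw [Nat.nth_eq_sInf]
      set A := {n | p x n ∧ ∀ j < k, Nat.nth (p x) j < n} with hA
      change sInf A = m ↔ (m ∈ A ∧ ∀ n, n < m → n ∉ A) ∨ (m = 0 ∧ ∀ n, n ∉ A)
      constructor
      · rintro rfl
        by_cases hne : A.Nonempty
        · exact .inl ⟨Nat.sInf_mem hne, fun n hn => Nat.notMem_of_lt_sInf hn⟩
        · rw [Set.not_nonempty_iff_eq_empty] at hne
          exact .inr (by simp [hne])
      · rintro (⟨h1, h2⟩ | ⟨rfl, h2⟩)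
        · exact le_antisymm (Nat.sInf_le h1)
            (not_lt.1 fun h => h2 _ h (Nat.sInf_mem ⟨m, h1⟩))
        · rw [Set.eq_empty_of_forall_notMem h2, Nat.sInf_empty]
    rw [hset]
    refine measurableSet_setOfPred.2 (((hQ m).and (Measurable.forall fun n => ?_)).or
      (measurable_const.and (Measurable.forall fun n => (hQ n).not)))
    exact measurable_const.imp (hQ n).not

theorem measurable_count {α : Type*} [MeasurableSpace α] {p : α → ℕ → Prop}
    [∀ x, DecidablePred (p x)]
    (hp : ∀ n, Measurable fun x => p x n) (n : ℕ) : Measurable fun x => Nat.count (p x) n := by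
  induction n with
  | zero => simp
  | succ n ih =>
    simp only [Nat.count_succ]
    exact ih.add (Measurable.ite (measurableSet_setOfPred.2 (hp n)) measurable_const
      measurable_const)

/-! ### Sample paths: measurability -/

section paths

variable {N : ℕ}

local notation "arr" => arrival (Ω := Primitives N) interArrivalOf
local notation "recvd" => Received (Ω := Primitives N) interArrivalOf serviceOf
local notation "recIdx" => receivedIndex (Ω := Primitives N) interArrivalOf serviceOf
local notation "recArr" => receivedArrival (Ω := Primitives N) interArrivalOf serviceOf
local notation "dep" => departure (Ω := Primitives N) interArrivalOf serviceOf
local notation "sysTime" => systemTime (Ω := Primitives N) interArrivalOf serviceOf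
local notation "interDep" => interDeparture (Ω := Primitives N) interArrivalOf serviceOf

theorem measurable_arrival (i : Fin N) (n : ℕ) : Measurable (arr i n) := by
  unfold arrival interArrivalOf; fun_prop

theorem measurable_received (i : Fin N) (n : ℕ) : Measurable fun z => recvd i n z := by
  have hs : Measurable (serviceOf i n) := measurable_pi_apply _
  refine Measurable.forall fun j => Measurable.forall fun m => Measurable.not ?_
  exact (measurableSet_setOfPred.1 (measurableSet_lt (measurable_arrival i n)
    (measurable_arrival j m))).and (measurableSet_setOfPred.1 (measurableSet_lt (measurable_arrival j m)
      ((measurable_arrival i n).add hs)))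

theorem measurable_receivedIndex (i : Fin N) (k : ℕ) : Measurable (recIdx i k) :=
  measurable_nth (measurable_received i) k

theorem measurable_eval_index {α : Type*} [MeasurableSpace α] {f : ℕ → α → ℝ} {g : α → ℕ}
    (hf : ∀ n, Measurable (f n)) (hg : Measurable g) : Measurable fun x => f (g x) x :=
  (measurable_from_prod_countable_right (f := fun q : ℕ × α => f q.1 q.2) hf).comp
    (hg.prodMk measurable_id)

theorem measurable_receivedArrival (i : Fin N) (k : ℕ) : Measurable (recArr i k) :=
  measurable_eval_index (f := fun n z => arr i n z) (measurable_arrival i)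
    (measurable_receivedIndex i k)

theorem measurable_departure (i : Fin N) (k : ℕ) : Measurable (dep i k) :=
  (measurable_receivedArrival i k).add
    (measurable_eval_index (f := fun n z => serviceOf i n z) (fun _ => measurable_pi_apply _)
      (measurable_receivedIndex i k))

theorem measurable_systemTime (i : Fin N) (k : ℕ) : Measurable (sysTime i k) :=
  (measurable_departure i k).sub (measurable_receivedArrival i k)

theorem measurable_interDeparture (i : Fin N) (k : ℕ) : Measurable (interDep i k) :=
  (measurable_departure i (k + 1)).sub (measurable_departure i k)

/-! ### Sample paths: translation in time -/

theorem arrival_delay (i : Fin N) (n : ℕ) (t : ℝ) (z : Primitives N) :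
    arr i n (delay Finset.univ t z) = arr i n z + t := by
  simp only [arrival, interArrivalOf, Finset.sum_range_succ' _ n]
  simp [delay, add_assoc]

theorem received_delay (i : Fin N) (n : ℕ) (t : ℝ) (z : Primitives N) :
    recvd i n (delay Finset.univ t z) ↔ recvd i n z := by
  have hs : serviceOf i n (delay Finset.univ t z) = serviceOf i n z := rfl
  simp only [Received, arrival_delay, hs]
  refine forall_congr' fun j => forall_congr' fun m => not_congr (and_congr ?_ ?_)
  · simp
  · rw [add_right_comm, add_lt_add_iff_right]

theorem receivedIndex_delay (i : Fin N) (k : ℕ) (t : ℝ) (z : Primitives N) :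
    recIdx i k (delay Finset.univ t z) = recIdx i k z := by
  simp only [receivedIndex, received_delay]

theorem receivedArrival_delay (i : Fin N) (k : ℕ) (t : ℝ) (z : Primitives N) :
    recArr i k (delay Finset.univ t z) = recArr i k z + t := by
  simp only [receivedArrival, receivedIndex_delay, arrival_delay]

theorem departure_delay (i : Fin N) (k : ℕ) (t : ℝ) (z : Primitives N) :
    dep i k (delay Finset.univ t z) = dep i k z + t := by
  have hs : ∀ n, serviceOf i n (delay Finset.univ t z) = serviceOf i n z := fun _ => rfl
  simp only [departure, receivedArrival_delay, receivedIndex_delay, hs, add_right_comm]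

theorem systemTime_delay (i : Fin N) (k : ℕ) (t : ℝ) (z : Primitives N) :
    sysTime i k (delay Finset.univ t z) = sysTime i k z := by
  simp only [systemTime, receivedArrival_delay, departure_delay, add_sub_add_right_eq_sub]

theorem interDeparture_delay (i : Fin N) (k : ℕ) (t : ℝ) (z : Primitives N) :
    interDep i k (delay Finset.univ t z) = interDep i k z := by
  simp only [interDeparture, departure_delay, add_sub_add_right_eq_sub]

/-! ### Sample paths: an additional first update -/

theorem arrival_prepend_of_ne {i j : Fin N} (h : j ≠ i) (n : ℕ) (s : ℝ) (z : Primitives N) :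
    arr i n (prepend j (0, s, z)) = arr i n z := by
  simp [arrival, interArrivalOf, prepend, prependArrival, prependService, h.symm]

theorem arrival_prepend_zero (j : Fin N) (s : ℝ) (z : Primitives N) :
    arr j 0 (prepend j (0, s, z)) = 0 := by
  simp [arrival, interArrivalOf, prepend, prependArrival]

theorem arrival_prepend_succ (j : Fin N) (n : ℕ) (s : ℝ) (z : Primitives N) :
    arr j (n + 1) (prepend j (0, s, z)) = arr j n z := by
  rw [arrival, Finset.sum_range_succ']
  simp [arrival, interArrivalOf, prepend, prependArrival, prependService]

theorem service_prepend_of_ne {i j : Fin N} (h : j ≠ i) (n : ℕ) (s : ℝ) (z : Primitives N) :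
    serviceOf i n (prepend j (0, s, z)) = serviceOf i n z := by
  simp [serviceOf, prepend, prependArrival, prependService, h.symm]

theorem service_prepend_zero (j : Fin N) (s : ℝ) (z : Primitives N) :
    serviceOf j 0 (prepend j (0, s, z)) = s := by
  simp [serviceOf, prepend, prependArrival, prependService]

theorem service_prepend_succ (j : Fin N) (n : ℕ) (s : ℝ) (z : Primitives N) :
    serviceOf j (n + 1) (prepend j (0, s, z)) = serviceOf j n z := by
  simp [serviceOf, prepend, prependArrival, prependService]

theorem first_le_arrival {z : Primitives N} (hz : ∀ q, 0 < z q) (i : Fin N) (n : ℕ) :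
    z (.inl (i, 0)) ≤ arr i n z := by
  rw [arrival, Finset.sum_range_succ']
  exact le_add_of_nonneg_left (Finset.sum_nonneg fun m _ => (hz _).le)

theorem arrival_pos {z : Primitives N} (hz : ∀ q, 0 < z q) (i : Fin N) (n : ℕ) : 0 < arr i n z :=
  (hz _).trans_le (first_le_arrival hz i n)

/-- A property of all arrival times does not see an additional update at time `0` if it holds for
`0`. -/
theorem forall_arrival_prepend_iff (j : Fin N) (s : ℝ) (z : Primitives N) (Q : ℝ → Prop)
    (hQ : Q 0) :
    (∀ l m, Q (arr l m (prepend j (0, s, z)))) ↔ ∀ l m, Q (arr l m z) := by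
  refine forall_congr' fun l => ?_
  by_cases h : j = l
  · subst h
    constructor
    · intro H m; simpa only [arrival_prepend_succ] using H (m + 1)
    · rintro H (_ | m)
      · rwa [arrival_prepend_zero]
      · rw [arrival_prepend_succ]; exact H m
  · simp only [arrival_prepend_of_ne h]

theorem received_prepend_of_ne {z : Primitives N} (hz : ∀ q, 0 < z q) {i j : Fin N} (h : j ≠ i)
    (n : ℕ) (s : ℝ) : recvd i n (prepend j (0, s, z)) ↔ recvd i n z := by
  unfold Received
  rw [arrival_prepend_of_ne h, service_prepend_of_ne h]
  exact forall_arrival_prepend_iff j s z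
    (fun x => ¬ (arr i n z < x ∧ x < arr i n z + serviceOf i n z))
    (fun H => H.1.not_gt (arrival_pos hz i n))

theorem received_prepend_succ {z : Primitives N} (hz : ∀ q, 0 < z q) (i : Fin N) (n : ℕ) (s : ℝ) :
    recvd i (n + 1) (prepend i (0, s, z)) ↔ recvd i n z := by
  unfold Received
  rw [arrival_prepend_succ, service_prepend_succ]
  exact forall_arrival_prepend_iff i s z
    (fun x => ¬ (arr i n z < x ∧ x < arr i n z + serviceOf i n z))
    (fun H => H.1.not_gt (arrival_pos hz i n))

theorem received_prepend_zero {z : Primitives N} (hz : ∀ q, 0 < z q) (i : Fin N) (s : ℝ) :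
    recvd i 0 (prepend i (0, s, z)) ↔ Clear s z := by
  unfold Received
  rw [arrival_prepend_zero, service_prepend_zero,
    forall_arrival_prepend_iff i s z (fun x => ¬ (0 < x ∧ x < 0 + s)) (by simp)]
  constructor
  · intro H l
    have := H l 0
    have h0 := arrival_pos hz l 0
    rw [zero_add] at this
    have h1 : s ≤ arr l 0 z := not_lt.1 fun h => this ⟨h0, h⟩
    simpa [arrival, interArrivalOf] using h1
  · rintro H l m ⟨-, h⟩
    rw [zero_add] at h
    exact h.not_ge ((H l).trans (first_le_arrival hz l m))

theorem receivedIndex_prepend_of_ne {z : Primitives N} (hz : ∀ q, 0 < z q) {i j : Fin N}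
    (h : j ≠ i) (k : ℕ) (s : ℝ) : recIdx i k (prepend j (0, s, z)) = recIdx i k z := by
  simp only [receivedIndex, received_prepend_of_ne hz h]

theorem receivedIndex_prepend_of_not_clear {z : Primitives N} (hz : ∀ q, 0 < z q) {i : Fin N}
    (hinf : {n | recvd i n z}.Infinite) (k : ℕ) {s : ℝ} (hc : ¬ Clear s z) :
    recIdx i k (prepend i (0, s, z)) = recIdx i k z + 1 := by
  rw [receivedIndex, nth_succ_of_not]
  · simp only [receivedIndex, received_prepend_succ hz]
  · rwa [received_prepend_zero hz]
  · simpa only [received_prepend_succ hz] using hinf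

theorem receivedIndex_prepend_succ {z : Primitives N} (hz : ∀ q, 0 < z q) {i : Fin N}
    (hinf : {n | recvd i n z}.Infinite) (k : ℕ) {s : ℝ} (hc : Clear s z) :
    recIdx i (k + 1) (prepend i (0, s, z)) = recIdx i k z + 1 := by
  rw [receivedIndex, nth_succ_of_zero]
  · simp only [receivedIndex, received_prepend_succ hz]
  · rwa [received_prepend_zero hz]
  · simpa only [received_prepend_succ hz] using hinf

theorem receivedIndex_prepend_zero {z : Primitives N} (hz : ∀ q, 0 < z q) {i : Fin N}
    {s : ℝ} (hc : Clear s z) : recIdx i 0 (prepend i (0, s, z)) = 0 :=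
  Nat.nth_zero_of_zero ((received_prepend_zero hz i s).2 hc)

theorem receivedArrival_prepend_of_ne {z : Primitives N} (hz : ∀ q, 0 < z q) {i j : Fin N}
    (h : j ≠ i) (k : ℕ) (s : ℝ) : recArr i k (prepend j (0, s, z)) = recArr i k z := by
  rw [receivedArrival, receivedIndex_prepend_of_ne hz h, arrival_prepend_of_ne h, receivedArrival]

theorem departure_prepend_of_ne {z : Primitives N} (hz : ∀ q, 0 < z q) {i j : Fin N}
    (h : j ≠ i) (k : ℕ) (s : ℝ) : dep i k (prepend j (0, s, z)) = dep i k z := by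
  rw [departure, receivedArrival_prepend_of_ne hz h, receivedIndex_prepend_of_ne hz h,
    service_prepend_of_ne h, departure]

theorem receivedArrival_prepend_of_not_clear {z : Primitives N} (hz : ∀ q, 0 < z q) {i : Fin N}
    (hinf : {n | recvd i n z}.Infinite) (k : ℕ) {s : ℝ} (hc : ¬ Clear s z) :
    recArr i k (prepend i (0, s, z)) = recArr i k z := by
  rw [receivedArrival, receivedIndex_prepend_of_not_clear hz hinf k hc, arrival_prepend_succ,
    receivedArrival]

theorem departure_prepend_of_not_clear {z : Primitives N} (hz : ∀ q, 0 < z q) {i : Fin N}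
    (hinf : {n | recvd i n z}.Infinite) (k : ℕ) {s : ℝ} (hc : ¬ Clear s z) :
    dep i k (prepend i (0, s, z)) = dep i k z := by
  rw [departure, receivedArrival_prepend_of_not_clear hz hinf k hc,
    receivedIndex_prepend_of_not_clear hz hinf k hc, service_prepend_succ, departure]

theorem receivedArrival_prepend_succ {z : Primitives N} (hz : ∀ q, 0 < z q) {i : Fin N}
    (hinf : {n | recvd i n z}.Infinite) (k : ℕ) {s : ℝ} (hc : Clear s z) :
    recArr i (k + 1) (prepend i (0, s, z)) = recArr i k z := by
  rw [receivedArrival, receivedIndex_prepend_succ hz hinf k hc, arrival_prepend_succ,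
    receivedArrival]

theorem departure_prepend_succ {z : Primitives N} (hz : ∀ q, 0 < z q) {i : Fin N}
    (hinf : {n | recvd i n z}.Infinite) (k : ℕ) {s : ℝ} (hc : Clear s z) :
    dep i (k + 1) (prepend i (0, s, z)) = dep i k z := by
  rw [departure, receivedArrival_prepend_succ hz hinf k hc,
    receivedIndex_prepend_succ hz hinf k hc, service_prepend_succ, departure]

theorem receivedArrival_prepend_zero {z : Primitives N} (hz : ∀ q, 0 < z q) {i : Fin N}
    {s : ℝ} (hc : Clear s z) : recArr i 0 (prepend i (0, s, z)) = 0 := by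
  rw [receivedArrival, receivedIndex_prepend_zero hz hc, arrival_prepend_zero]

theorem departure_prepend_zero {z : Primitives N} (hz : ∀ q, 0 < z q) {i : Fin N}
    {s : ℝ} (hc : Clear s z) : dep i 0 (prepend i (0, s, z)) = s := by
  rw [departure, receivedArrival_prepend_zero hz hc, receivedIndex_prepend_zero hz hc,
    service_prepend_zero, zero_add]

theorem measurableSet_atLeastTimes (i : Fin N) (k : ℕ) :
    MeasurableSet {z | AtLeastTimes (fun n => recvd i n z) k} := by
  classical
  refine measurableSet_setOfPred.2 (Measurable.exists fun n => ?_)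
  exact measurableSet_setOfPred.1 (measurableSet_le measurable_const
    (measurable_count (measurable_received i) n))

theorem atLeastTimes_delay (i : Fin N) (k : ℕ) (t : ℝ) (z : Primitives N) :
    AtLeastTimes (fun n => recvd i n (delay Finset.univ t z)) k ↔
      AtLeastTimes (fun n => recvd i n z) k := by
  simp only [received_delay]

theorem atLeastTimes_prepend_of_ne {z : Primitives N} (hz : ∀ q, 0 < z q) {i j : Fin N}
    (h : j ≠ i) (k : ℕ) (s : ℝ) :
    AtLeastTimes (fun n => recvd i n (prepend j (0, s, z))) k ↔
      AtLeastTimes (fun n => recvd i n z) k := by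
  simp only [received_prepend_of_ne hz h]

theorem atLeastTimes_prepend_of_clear {z : Primitives N} (hz : ∀ q, 0 < z q) {i : Fin N}
    (k : ℕ) {s : ℝ} (hc : Clear s z) :
    AtLeastTimes (fun n => recvd i n (prepend i (0, s, z))) (k + 1) ↔
      AtLeastTimes (fun n => recvd i n z) k := by
  rw [atLeastTimes_succ_of_zero ((received_prepend_zero hz i s).2 hc)]
  simp only [received_prepend_succ hz]

theorem atLeastTimes_prepend_of_not_clear {z : Primitives N} (hz : ∀ q, 0 < z q) {i : Fin N}
    (k : ℕ) {s : ℝ} (hc : ¬ Clear s z) :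
    AtLeastTimes (fun n => recvd i n (prepend i (0, s, z))) (k + 1) ↔
      AtLeastTimes (fun n => recvd i n z) (k + 1) := by
  rw [atLeastTimes_succ_of_not (by rwa [received_prepend_zero hz])]
  simp only [received_prepend_succ hz]

end paths

/-! ### The renewal equation -/

theorem integral_expMeasure {r : ℝ} (hr : 0 < r) (f : ℝ → ℂ) :
    ∫ t, f t ∂expMeasure r = ∫ t in Set.Ioi (0 : ℝ), (r : ℂ) * Complex.exp (-r * t) * f t := by
  rw [expMeasure_eq, ← integral_indicator measurableSet_Ioi,
    integral_withDensity_eq_integral_toReal_smul (measurable_exponentialPDF r)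
      (Filter.Eventually.of_forall fun _ => ENNReal.ofReal_lt_top)]
  refine integral_congr_ae ?_
  filter_upwards [compl_mem_ae_iff.2 (measure_singleton (μ := volume) (0 : ℝ))] with t ht
  rcases lt_or_gt_of_ne (show t ≠ 0 from ht) with h | h
  · rw [Set.indicator_of_notMem (by simpa using h.le), exponentialPDF_of_neg h]; simp
  · rw [Set.indicator_of_mem (by simpa using h), exponentialPDF_of_nonneg h.le,
      ENNReal.toReal_ofReal (by positivity), Complex.real_smul]
    push_cast; ring_nf

theorem integral_expMeasure_cexp {r : ℝ} (hr : 0 < r) {w : ℂ} (hw : w.re < r) :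
    ∫ t, Complex.exp (w * t) ∂expMeasure r = r / (r - w) := by
  have hne : w - r ≠ 0 := fun h => by
    have := congrArg Complex.re h; simp at this; linarith
  have hne' : (r : ℂ) - w ≠ 0 := fun h => hne (by linear_combination -h)
  rw [integral_expMeasure hr]
  simp_rw [mul_assoc, ← Complex.exp_add]
  rw [integral_const_mul]
  have : ∀ t : ℝ, -(r : ℂ) * t + w * t = (w - r) * t := fun t => by ring
  simp_rw [this]
  rw [integral_exp_mul_complex_Ioi (by simpa using hw)]
  simp only [Complex.ofReal_zero, mul_zero, Complex.exp_zero]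
  field_simp
  ring

section renewal

variable {N : ℕ} {lam : Fin N → ℝ} {mu : ℝ}

/-- A bounded observable of the system that picks up the phase `e^{iθt}` when all arrivals are
postponed by `t`. -/
structure HasFrequency (θ : ℝ) (F : Primitives N → ℂ) : Prop where
  measurable : Measurable F
  norm_le_one : ∀ z, ‖F z‖ ≤ 1
  delay : ∀ t z, F (delay Finset.univ t z) = Complex.exp (θ * t * Complex.I) * F z

theorem measurableSet_clear : MeasurableSet {p : ℝ × Primitives N | Clear p.1 p.2} := by
  simp only [Clear, Set.ofPred_forall]
  exact .iInter fun l => measurableSet_le measurable_fst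
    ((measurable_pi_apply _).comp measurable_snd)

theorem setIntegral_clear (hlam : ∀ j, 0 < lam j) (hmu : 0 < mu) {θ : ℝ} {F : Primitives N → ℂ}
    (hF : HasFrequency θ F) {s : ℝ} (hs : 0 ≤ s) :
    ∫ z in {z | Clear s z}, F z ∂primitiveLaw lam mu =
      Complex.exp ((θ * Complex.I - ∑ j, lam j) * s) * ∫ z, F z ∂primitiveLaw lam mu := by
  have h := primitiveLaw_restrict hlam hmu Finset.univ hs
  simp only [Finset.mem_univ, true_imp_iff] at h
  change ∫ z, F z ∂(primitiveLaw lam mu).restrict {z | ∀ l, s ≤ z (.inl (l, 0))} = _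
  rw [h, integral_smul_measure, integral_map (measurable_delay_const _ s).aemeasurable
    hF.measurable.aestronglyMeasurable]
  simp only [hF.delay]
  rw [integral_const_mul, ENNReal.toReal_ofReal (Real.exp_pos _).le, Complex.real_smul, ← mul_assoc]
  congr 1
  push_cast
  rw [← Complex.exp_add]; ring_nf

open scoped Classical in
/-- Expectation of an observable of frequency `v`, with a phase depending on an independent service
time, on the event that no arrival interrupts this service. -/
theorem integral_clear (hlam : ∀ j, 0 < lam j) (hmu : 0 < mu) {v : ℝ}
    {f : Primitives N → ℂ} (hf : HasFrequency v f) (u : ℝ) :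
    ∫ p, (if Clear p.1 p.2 then Complex.exp (u * p.1 * Complex.I) * f p.2 else 0)
        ∂((expMeasure mu).prod (primitiveLaw lam mu)) =
      mu / (∑ j, lam j + mu - (u + v) * Complex.I) * ∫ z, f z ∂primitiveLaw lam mu := by
  have := isProbabilityMeasure_primitiveLaw hlam hmu
  have := isProbabilityMeasure_expMeasure hmu
  have hsum : 0 ≤ ∑ j, lam j := Finset.sum_nonneg fun j _ => (hlam j).le
  have hm := hf.measurable
  have hmeas : Measurable fun p : ℝ × Primitives N =>
      if Clear p.1 p.2 then Complex.exp (u * p.1 * Complex.I) * f p.2 else 0 :=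
    Measurable.ite measurableSet_clear (by fun_prop) measurable_const
  rw [integral_prod]
  · have h1 : ∀ᵐ s ∂expMeasure mu,
        ∫ z, (if Clear s z then Complex.exp (u * s * Complex.I) * f z else 0)
          ∂primitiveLaw lam mu =
        Complex.exp (((u + v) * Complex.I - ∑ j, lam j) * s) * ∫ z, f z ∂primitiveLaw lam mu := by
      filter_upwards [ae_pos_expMeasure mu] with s hs
      have hset : MeasurableSet {z : Primitives N | Clear s z} :=
        measurable_prodMk_left measurableSet_clear
      have h2 : ∀ z : Primitives N,
          (if Clear s z then Complex.exp (u * s * Complex.I) * f z else 0) =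
          {z | Clear s z}.indicator (fun z => Complex.exp (u * s * Complex.I) * f z) z := fun z => by
        by_cases h : Clear s z
        · rw [if_pos h, Set.indicator_of_mem (s := {z | Clear s z}) h]
        · rw [if_neg h, Set.indicator_of_notMem (s := {z | Clear s z}) h]
      simp_rw [h2]
      rw [integral_indicator hset, integral_const_mul, setIntegral_clear hlam hmu hf hs.le,
        ← mul_assoc, ← Complex.exp_add]
      ring_nf
    rw [integral_congr_ae h1, integral_mul_const, integral_expMeasure_cexp hmu]
    · congr 2; push_cast; ring
    · simp; linarith
  · refine Integrable.of_bound hmeas.aestronglyMeasurable 1 (.of_forall fun p => ?_)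
    split_ifs
    · rw [norm_mul, ← Complex.ofReal_mul, Complex.norm_exp_ofReal_mul_I, one_mul]
      exact hf.norm_le_one _
    · simp

open scoped Classical in
/-- The renewal equation of source `i`, for an observable `F` which only notices the first arrival
if it belongs to source `i` and its service is not interrupted; in that case the observable takes
the value `H`. -/
theorem renewal (hlam : ∀ j, 0 < lam j) (hmu : 0 < mu) (i : Fin N) {θ : ℝ}
    {F : Primitives N → ℂ} (hF : HasFrequency θ F) {H : ℝ × Primitives N → ℂ} (hH : Measurable H)
    (hH1 : ∀ p, ‖H p‖ ≤ 1)
    (hne : ∀ᵐ z ∂primitiveLaw lam mu, ∀ j, j ≠ i → ∀ s, F (prepend j (0, s, z)) = F z)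
    (hi : ∀ᵐ z ∂primitiveLaw lam mu, ∀ s,
      F (prepend i (0, s, z)) = if Clear s z then H (s, z) else F z) :
    (∫ z, F z ∂primitiveLaw lam mu) *
        (lam i * mu - θ * Complex.I * (∑ j, lam j + mu - θ * Complex.I)) =
      lam i * (∑ j, lam j + mu - θ * Complex.I) *
        ∫ p, (if Clear p.1 p.2 then H p else 0)
          ∂((expMeasure mu).prod (primitiveLaw lam mu)) := by
  have hL : 0 < ∑ l, lam l := Finset.sum_pos (fun l _ => hlam l) ⟨i, Finset.mem_univ i⟩
  have := isProbabilityMeasure_primitiveLaw hlam hmu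
  have := isProbabilityMeasure_expMeasure hmu
  have := isProbabilityMeasure_expMeasure hL
  set L : ℝ := ∑ l, lam l with hLdef
  set ν := primitiveLaw lam mu with hν
  set ρ := (expMeasure mu).prod ν with hρ
  set φ := ∫ z, F z ∂ν with hφ
  set J := ∫ p, (if Clear p.1 p.2 then H p else 0) ∂ρ with hJ
  have hFm := hF.measurable
  -- regeneration, with the time of the first arrival integrated out
  have hsplit : φ = ∑ j, ((lam j / L : ℝ) : ℂ) *
      (L / (L - θ * Complex.I) * ∫ p, F (prepend j (0, p)) ∂ρ) := by
    have hdec := primitiveLaw_eq_sum hlam hmu i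
    rw [hφ]
    nth_rw 1 [hν, hdec]
    rw [integral_finsetSum_measure]
    · refine Finset.sum_congr rfl fun j _ => ?_
      rw [integral_smul_measure, integral_map (measurable_delay_prepend j).aemeasurable
        hFm.aestronglyMeasurable, ENNReal.toReal_ofReal (div_pos (hlam j) hL).le, Complex.real_smul]
      simp only [hF.delay]
      rw [← integral_expMeasure_cexp hL (w := θ * Complex.I) (by simpa using hL),
        ← integral_prod_mul]
      simp only [mul_right_comm]
      rfl
    · intro j _
      have := Measure.isProbabilityMeasure_map (μ := (expMeasure L).prod ρ)
        (measurable_delay_prepend (N := N) j).aemeasurable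
      exact (Integrable.of_bound hFm.aestronglyMeasurable 1
        (.of_forall hF.norm_le_one)).smul_measure ENNReal.ofReal_ne_top
  have hsnd : Measure.QuasiMeasurePreserving Prod.snd ρ ν := Measure.quasiMeasurePreserving_snd
  -- a first arrival of another source leaves `F` unchanged
  have hKne : ∀ j, j ≠ i → ∫ p, F (prepend j (0, p)) ∂ρ = φ := by
    intro j hj
    have : ∀ᵐ p ∂ρ, F (prepend j (0, p)) = F p.2 := by
      filter_upwards [hsnd.ae hne] with p hp using hp j hj p.1
    rw [integral_congr_ae this, hρ, integral_fun_snd]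
    simp [hφ]
  -- a first arrival of source `i` changes `F` only if its service is not interrupted; what is lost
  -- then is computed by `integral_clear`, since `F` itself has a frequency
  have hKi : ∫ p, F (prepend i (0, p)) ∂ρ = J + φ - mu / (L + mu - θ * Complex.I) * φ := by
    have h1 : ∀ᵐ p ∂ρ, F (prepend i (0, p)) = (if Clear p.1 p.2 then H p else 0) + F p.2 -
        (if Clear p.1 p.2 then Complex.exp ((0 : ℝ) * p.1 * Complex.I) * F p.2 else 0) := by
      filter_upwards [hsnd.ae hi] with p hp
      rw [show prepend i (0, p) = prepend i (0, p.1, p.2) from rfl, hp]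
      split_ifs <;> simp
    have i1 : Integrable (fun p => if Clear p.1 p.2 then H p else 0) ρ :=
      Integrable.of_bound (Measurable.ite measurableSet_clear hH
        measurable_const).aestronglyMeasurable 1 (.of_forall fun p => by
          split_ifs
          · exact hH1 p
          · simp)
    have i2 : Integrable (fun p => F p.2) ρ :=
      Integrable.of_bound (hFm.comp measurable_snd).aestronglyMeasurable 1
        (.of_forall fun p => hF.norm_le_one _)
    have i3 : Integrable (fun p : ℝ × Primitives N => if Clear p.1 p.2 then
        Complex.exp ((0 : ℝ) * p.1 * Complex.I) * F p.2 else 0) ρ :=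
      Integrable.of_bound (Measurable.ite measurableSet_clear (by fun_prop)
        measurable_const).aestronglyMeasurable 1 (.of_forall fun p => by
          split_ifs
          · simpa using hF.norm_le_one _
          · simp)
    have h2 := integral_sub (i1.add i2) i3
    simp only [Pi.add_apply] at h2
    rw [integral_congr_ae h1, h2, integral_add i1 i2,
      integral_clear hlam hmu hF 0, hρ, integral_fun_snd]
    simp [hφ, hJ, hρ, hν, hLdef]
  have hsum : φ = L / (L - θ * Complex.I) *
      (φ + lam i / L * ((J + φ - mu / (L + mu - θ * Complex.I) * φ) - φ)) := by
    have h2 : ∀ j, ((lam j / L : ℝ) : ℂ) *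
        (L / (L - θ * Complex.I) * ∫ p, F (prepend j (0, p)) ∂ρ) =
        lam j * (1 / (L - θ * Complex.I) * φ) + (if j = i then lam i / (L - θ * Complex.I) *
          ((J + φ - mu / (L + mu - θ * Complex.I) * φ) - φ) else 0) := by
      intro j
      have hLc : (L : ℂ) ≠ 0 := by exact_mod_cast hL.ne'
      split_ifs with h
      · rw [h, hKi]; push_cast; field_simp; ring
      · rw [hKne j h]; push_cast; field_simp; ring
    nth_rw 1 [hsplit]
    simp_rw [h2]
    rw [Finset.sum_add_distrib, Finset.sum_ite_eq' Finset.univ i, if_pos (Finset.mem_univ i),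
      ← Finset.sum_mul, ← Complex.ofReal_sum, ← hLdef]
    have hLc : (L : ℂ) ≠ 0 := by exact_mod_cast hL.ne'
    field_simp
  have n1 : (L : ℂ) - θ * Complex.I ≠ 0 := fun h => by
    have := congrArg Complex.re h; simp at this; exact hL.ne' this
  have n2 : (L : ℂ) + mu - θ * Complex.I ≠ 0 := fun h => by
    have := congrArg Complex.re h; simp at this; linarith
  have n3 : (L : ℂ) ≠ 0 := by exact_mod_cast hL.ne'
  field_simp at hsum
  linear_combination hsum

end renewal

/-! ### Characteristic functions of the queue -/

section charFun

variable {N : ℕ} {lam : Fin N → ℝ} {mu : ℝ}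

local notation "recvd" => Received (Ω := Primitives N) interArrivalOf serviceOf
local notation "dep" => departure (Ω := Primitives N) interArrivalOf serviceOf
local notation "sysTime" => systemTime (Ω := Primitives N) interArrivalOf serviceOf
local notation "interDep" => interDeparture (Ω := Primitives N) interArrivalOf serviceOf

/-- The renewal equation when an uninterrupted first service of length `s` of source `i` contributes
the phase `e^{ius}` and is followed by an observable of frequency `v`. -/
theorem renewal_phase (hlam : ∀ j, 0 < lam j) (hmu : 0 < mu) (i : Fin N) {θ u v : ℝ}
    {F f : Primitives N → ℂ} (hF : HasFrequency θ F) (hf : HasFrequency v f)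
    (hne : ∀ᵐ z ∂primitiveLaw lam mu, ∀ j, j ≠ i → ∀ s, F (prepend j (0, s, z)) = F z)
    (hc : ∀ᵐ z ∂primitiveLaw lam mu, ∀ s, Clear s z →
      F (prepend i (0, s, z)) = Complex.exp (u * s * Complex.I) * f z)
    (hnc : ∀ᵐ z ∂primitiveLaw lam mu, ∀ s, ¬ Clear s z → F (prepend i (0, s, z)) = F z) :
    (∫ z, F z ∂primitiveLaw lam mu) *
        (lam i * mu - θ * Complex.I * (∑ j, lam j + mu - θ * Complex.I)) =
      lam i * (∑ j, lam j + mu - θ * Complex.I) *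
        (mu / (∑ j, lam j + mu - (u + v) * Complex.I) * ∫ z, f z ∂primitiveLaw lam mu) := by
  classical
  have hm := hf.measurable
  rw [← integral_clear hlam hmu hf u]
  refine renewal hlam hmu i hF (H := fun p => Complex.exp (u * p.1 * Complex.I) * f p.2)
    (by fun_prop) (fun p => ?_) hne ?_
  · rw [norm_mul, ← Complex.ofReal_mul, Complex.norm_exp_ofReal_mul_I, one_mul]
    exact hf.norm_le_one _
  · filter_upwards [hc, hnc] with z h1 h2 s
    split_ifs with h
    exacts [h1 s h, h2 s h]

theorem rate_sub_ne_zero (hlam : ∀ j, 0 < lam j) (hmu : 0 < mu) (θ : ℝ) :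
    ((∑ j, lam j : ℝ) : ℂ) + mu - θ * Complex.I ≠ 0 := fun h => by
  have hsum : 0 ≤ ∑ j, lam j := Finset.sum_nonneg fun j _ => (hlam j).le
  have := congrArg Complex.re h
  simp at this
  linarith

/-- In the situation of the renewal equation, an observable that is insensitive to translations
keeps its expectation when one successful reception is skipped. -/
theorem integral_eq_of_renewal (hlam : ∀ j, 0 < lam j) (hmu : 0 < mu) (i : Fin N)
    {F f : Primitives N → ℂ} (hF : HasFrequency 0 F) (hf : HasFrequency 0 f)
    (hne : ∀ᵐ z ∂primitiveLaw lam mu, ∀ j, j ≠ i → ∀ s, F (prepend j (0, s, z)) = F z)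
    (hc : ∀ᵐ z ∂primitiveLaw lam mu, ∀ s, Clear s z → F (prepend i (0, s, z)) = f z)
    (hnc : ∀ᵐ z ∂primitiveLaw lam mu, ∀ s, ¬ Clear s z → F (prepend i (0, s, z)) = F z) :
    ∫ z, F z ∂primitiveLaw lam mu = ∫ z, f z ∂primitiveLaw lam mu := by
  have h := renewal_phase hlam hmu i (u := 0) hF hf hne
    (by simpa using hc) hnc
  have n1 := rate_sub_ne_zero hlam hmu 0
  have n2 : (lam i : ℂ) ≠ 0 := by exact_mod_cast (hlam i).ne'
  have n3 : (mu : ℂ) ≠ 0 := by exact_mod_cast hmu.ne'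
  simp only [Complex.ofReal_zero, zero_mul, sub_zero, add_zero] at h n1
  field_simp at h
  linear_combination h

open scoped Classical in
theorem hasFrequency_atLeastTimes (i : Fin N) (k : ℕ) :
    HasFrequency 0 fun z : Primitives N =>
      if AtLeastTimes (fun n => recvd i n z) k then (1 : ℂ) else 0 where
  measurable := Measurable.ite (measurableSet_atLeastTimes i k) measurable_const measurable_const
  norm_le_one z := by split_ifs <;> simp
  delay t z := by simp only [atLeastTimes_delay]; simp

theorem ae_infinite_received (hlam : ∀ j, 0 < lam j) (hmu : 0 < mu) (i : Fin N) :
    ∀ᵐ z ∂primitiveLaw lam mu, {n | recvd i n z}.Infinite := by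
  classical
  have := isProbabilityMeasure_primitiveLaw hlam hmu
  have hpos := ae_pos_primitiveLaw hlam hmu
  have key : ∀ k, ∫ z, (if AtLeastTimes (fun n => recvd i n z) k then (1 : ℂ) else 0)
      ∂primitiveLaw lam mu = 1 := by
    intro k
    induction k with
    | zero => simp [AtLeastTimes]
    | succ k ih =>
      refine Eq.trans ?_ ih
      refine integral_eq_of_renewal hlam hmu i (hasFrequency_atLeastTimes i (k + 1))
        (hasFrequency_atLeastTimes i k) ?_ ?_ ?_
      · filter_upwards [hpos] with z hz j hj s
        simp only [atLeastTimes_prepend_of_ne hz hj]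
      · filter_upwards [hpos] with z hz s hs
        simp only [atLeastTimes_prepend_of_clear hz k hs]
      · filter_upwards [hpos] with z hz s hs
        simp only [atLeastTimes_prepend_of_not_clear hz k hs]
  have hall : ∀ k, ∀ᵐ z ∂primitiveLaw lam mu, AtLeastTimes (fun n => recvd i n z) k := by
    intro k
    have hset := measurableSet_atLeastTimes i k
    have h1 : (primitiveLaw lam mu).real {z | AtLeastTimes (fun n => recvd i n z) k} = 1 := by
      have h2 := key k
      have h3 : ∀ z, (if AtLeastTimes (fun n => recvd i n z) k then (1 : ℂ) else 0) =
          {z | AtLeastTimes (fun n => recvd i n z) k}.indicator (fun _ => 1) z := fun z => rfl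
      simp_rw [h3] at h2
      rw [integral_indicator hset, setIntegral_const] at h2
      simpa using h2
    have h4 := (prob_compl_eq_zero_iff hset).2
      ((ENNReal.toReal_eq_one_iff _).1 h1)
    exact h4
  filter_upwards [ae_all_iff.2 hall] with z hz using infinite_of_forall_atLeastTimes hz

theorem hasFrequency_departure (i : Fin N) (v : ℝ) :
    HasFrequency v fun z : Primitives N => Complex.exp (v * dep i 0 z * Complex.I) where
  measurable := by
    have := measurable_departure i 0
    fun_prop
  norm_le_one z := by rw [← Complex.ofReal_mul, Complex.norm_exp_ofReal_mul_I]
  delay t z := by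
    rw [departure_delay, ← Complex.exp_add]; push_cast; ring_nf

theorem hasFrequency_system_interDeparture (i : Fin N) (k : ℕ) (u v : ℝ) :
    HasFrequency 0 fun z : Primitives N =>
      Complex.exp (((u * sysTime i k z + v * interDep i k z : ℝ) : ℂ) * Complex.I) where
  measurable := by
    have := measurable_systemTime i k
    have := measurable_interDeparture i k
    fun_prop
  norm_le_one z := by rw [Complex.norm_exp_ofReal_mul_I]
  delay t z := by rw [systemTime_delay, interDeparture_delay]; simp

/-- Characteristic function of the first departure time of source `i`. -/
theorem integral_departure_zero (hlam : ∀ j, 0 < lam j) (hmu : 0 < mu) (i : Fin N) (v : ℝ) :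
    (∫ z, Complex.exp (v * dep i 0 z * Complex.I) ∂primitiveLaw lam mu) *
        (lam i * mu - v * Complex.I * (∑ j, lam j + mu - v * Complex.I)) = lam i * mu := by
  have := isProbabilityMeasure_primitiveLaw hlam hmu
  have hpos := ae_pos_primitiveLaw hlam hmu
  have h1 : HasFrequency 0 fun _ : Primitives N => (1 : ℂ) :=
    ⟨measurable_const, by simp, by simp⟩
  have h := renewal_phase hlam hmu i (u := v) (hasFrequency_departure i v) h1 ?_ ?_ ?_
  · have n1 := rate_sub_ne_zero hlam hmu v
    rw [h]
    simp only [Complex.ofReal_zero, add_zero, integral_const, probReal_univ, one_smul]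
    field_simp
  · filter_upwards [hpos] with z hz j hj s
    rw [departure_prepend_of_ne hz hj]
  · filter_upwards [hpos] with z hz s hs
    rw [departure_prepend_zero hz hs, mul_one]
  · filter_upwards [hpos, ae_infinite_received hlam hmu i] with z hz hinf s hs
    rw [departure_prepend_of_not_clear hz hinf 0 hs]

/-- Joint characteristic function of the system time and the following inter-departure time: they
are independent, the former is exponential with rate `∑ j, lam j + mu`, and the latter is
distributed as the first departure time. -/
theorem integral_system_interDeparture (hlam : ∀ j, 0 < lam j) (hmu : 0 < mu) (i : Fin N) (k : ℕ)
    (u v : ℝ) :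
    (∫ z, Complex.exp (((u * sysTime i k z + v * interDep i k z : ℝ) : ℂ) * Complex.I)
        ∂primitiveLaw lam mu) * ((∑ j, lam j + mu - u * Complex.I) *
        (lam i * mu - v * Complex.I * (∑ j, lam j + mu - v * Complex.I))) =
      (∑ j, lam j + mu) * (lam i * mu) := by
  have hpos := ae_pos_primitiveLaw hlam hmu
  have hinf := ae_infinite_received hlam hmu i
  have hne : ∀ k, ∀ᵐ z ∂primitiveLaw lam mu, ∀ j, j ≠ i → ∀ s,
      Complex.exp (((u * sysTime i k (prepend j (0, s, z)) +
        v * interDep i k (prepend j (0, s, z)) : ℝ) : ℂ) * Complex.I) =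
      Complex.exp (((u * sysTime i k z + v * interDep i k z : ℝ) : ℂ) * Complex.I) := by
    intro k
    filter_upwards [hpos] with z hz j hj s
    simp only [systemTime, interDeparture, departure_prepend_of_ne hz hj,
      receivedArrival_prepend_of_ne hz hj]
  have hnc : ∀ k, ∀ᵐ z ∂primitiveLaw lam mu, ∀ s, ¬ Clear s z →
      Complex.exp (((u * sysTime i k (prepend i (0, s, z)) +
        v * interDep i k (prepend i (0, s, z)) : ℝ) : ℂ) * Complex.I) =
      Complex.exp (((u * sysTime i k z + v * interDep i k z : ℝ) : ℂ) * Complex.I) := by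
    intro k
    filter_upwards [hpos, hinf] with z hz hi s hs
    simp only [systemTime, interDeparture, departure_prepend_of_not_clear hz hi _ hs,
      receivedArrival_prepend_of_not_clear hz hi _ hs]
  induction k with
  | zero =>
    -- an uninterrupted first service of length `s` is the system time, and the first departure of
    -- the remaining system, seen from the end of this service, is the inter-departure time
    have h := renewal_phase hlam hmu i (u := u - v) (hasFrequency_system_interDeparture i 0 u v)
      (hasFrequency_departure i v) (hne 0) ?_ (hnc 0)
    · have n1 := rate_sub_ne_zero hlam hmu u
      have n2 : (lam i : ℂ) ≠ 0 := by exact_mod_cast (hlam i).ne'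
      have n3 : (mu : ℂ) ≠ 0 := by exact_mod_cast hmu.ne'
      have hD := integral_departure_zero hlam hmu i v
      simp only [Complex.ofReal_zero, zero_mul, sub_zero, Complex.ofReal_sub,
        sub_add_cancel] at h
      generalize (∫ z, Complex.exp (v * dep i 0 z * Complex.I) ∂primitiveLaw lam mu) = D at h hD
      generalize (∫ z, Complex.exp (((u * sysTime i 0 z + v * interDep i 0 z : ℝ) : ℂ) * Complex.I)
        ∂primitiveLaw lam mu) = W at h ⊢
      have h' : W * (((∑ j, lam j : ℝ) : ℂ) + mu - u * Complex.I) =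
          (((∑ j, lam j : ℝ) : ℂ) + mu) * D := by
        generalize ((∑ j, lam j : ℝ) : ℂ) + mu - u * Complex.I = q at h n1
        field_simp at h
        exact h
      rw [← mul_assoc, h', mul_assoc, hD]
    · filter_upwards [hpos, hinf] with z hz hi s hs
      simp only [systemTime, interDeparture, departure_prepend_succ hz hi _ hs,
        departure_prepend_zero hz hs, receivedArrival_prepend_zero hz hs, zero_add]
      rw [← Complex.exp_add]; push_cast; ring_nf
  | succ k ih =>
    rw [← ih, integral_eq_of_renewal hlam hmu i (hasFrequency_system_interDeparture i (k + 1) u v)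
      (hasFrequency_system_interDeparture i k u v) (hne _) ?_ (hnc _)]
    filter_upwards [hpos, hinf] with z hz hi s hs
    simp only [systemTime, interDeparture, departure_prepend_succ hz hi _ hs,
      receivedArrival_prepend_succ hz hi _ hs]

end charFun

/-! ### Densities -/

/-- A nonnegative function supported on the half-line is a density of a random variable whose
characteristic function is its Fourier transform. -/
theorem isDensityOf_of_charFun {Ω : Type*} [MeasurableSpace Ω] {P : Measure Ω}
    [IsProbabilityMeasure P] {Z : Ω → ℝ} (hZ : Measurable Z) {g : ℝ → ℝ} (hg : Measurable g)
    (hg0 : ∀ x, 0 ≤ x → 0 ≤ g x) (hgi : IntegrableOn g (Set.Ioi 0))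
    (h : ∀ t : ℝ, ∫ ω, Complex.exp (t * Z ω * Complex.I) ∂P =
      ∫ x in Set.Ioi (0 : ℝ), (g x : ℂ) * Complex.exp (t * x * Complex.I)) :
    IsDensityOf P Z (fun x => if 0 ≤ x then g x else 0) := by
  have hm : Measurable fun x => if 0 ≤ x then g x else 0 :=
    Measurable.ite measurableSet_Ici hg measurable_const
  have hn : ∀ x, 0 ≤ if 0 ≤ x then g x else 0 := fun x => by
    split_ifs with hx
    exacts [hg0 x hx, le_rfl]
  have hae : (fun x => if 0 ≤ x then g x else 0) =ᵐ[volume] (Set.Ioi 0).indicator g := by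
    filter_upwards [compl_mem_ae_iff.2 (measure_singleton (μ := volume) (0 : ℝ))] with x hx
    rcases lt_or_gt_of_ne (show x ≠ 0 from hx) with h | h
    · rw [if_neg h.not_ge, Set.indicator_of_notMem (by simpa using h.le)]
    · rw [if_pos h.le, Set.indicator_of_mem (by simpa using h)]
  have hint : Integrable fun x => if 0 ≤ x then g x else 0 :=
    (hgi.integrable_indicator measurableSet_Ioi).congr hae.symm
  refine ⟨hm, hn, hZ.aemeasurable, ?_⟩
  have := isFiniteMeasure_withDensity_ofReal hint.2
  refine Measure.ext_of_charFun (funext fun t => ?_)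
  rw [charFun_apply_real, charFun_apply_real, integral_map hZ.aemeasurable (by fun_prop), h t,
    integral_withDensity_eq_integral_toReal_smul hm.ennreal_ofReal
      (Filter.Eventually.of_forall fun _ => ENNReal.ofReal_lt_top),
    ← integral_indicator measurableSet_Ioi]
  refine integral_congr_ae ?_
  filter_upwards [hae] with x hx
  rw [ENNReal.toReal_ofReal (hn x), hx]
  by_cases h0 : x ∈ Set.Ioi (0 : ℝ)
  · rw [Set.indicator_of_mem h0, Set.indicator_of_mem h0, Complex.real_smul]
  · rw [Set.indicator_of_notMem h0, Set.indicator_of_notMem h0, zero_smul]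

theorem integral_Ioi_exp_mul_cexp {r : ℝ} (hr : r < 0) (t : ℝ) :
    IntegrableOn (fun x : ℝ => (Real.exp (r * x) : ℂ) * Complex.exp (t * x * Complex.I))
        (Set.Ioi 0) ∧
      ∫ x in Set.Ioi (0 : ℝ), (Real.exp (r * x) : ℂ) * Complex.exp (t * x * Complex.I) =
        -1 / (r + t * Complex.I) := by
  have he : ∀ x : ℝ, (Real.exp (r * x) : ℂ) * Complex.exp (t * x * Complex.I) =
      Complex.exp ((r + t * Complex.I) * x) := fun x => by
    push_cast; rw [← Complex.exp_add]; ring_nf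
  simp_rw [he]
  refine ⟨integrableOn_exp_mul_complex_Ioi (by simpa using hr) 0, ?_⟩
  rw [integral_exp_mul_complex_Ioi (by simpa using hr)]
  simp

theorem add_mul_I_ne_zero {r : ℝ} (hr : r < 0) (t : ℝ) : (r : ℂ) + t * Complex.I ≠ 0 := fun h => by
  have := congrArg Complex.re h
  simp at this
  linarith

theorem exp_density_nonneg {a b : ℝ} (hab : a ≠ b) {x : ℝ} (hx : 0 ≤ x) :
    0 ≤ (Real.exp (a * x) - Real.exp (b * x)) / (a - b) := by
  rcases lt_or_gt_of_ne hab with h | h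
  · refine div_nonneg_of_nonpos (sub_nonpos.2 ?_) (sub_nonpos.2 h.le)
    exact Real.exp_le_exp.2 (mul_le_mul_of_nonneg_right h.le hx)
  · refine div_nonneg (sub_nonneg.2 ?_) (sub_nonneg.2 h.le)
    exact Real.exp_le_exp.2 (mul_le_mul_of_nonneg_right h.le hx)

/-- The point `α * x` is an average of `0` and `β * x`, and the exponential function is convex. With
`α = -a` and `β = -b` this is the nonnegativity of the density of the peak age. -/
theorem exp_mul_le_of_convex {α β : ℝ} (hα : 0 < α) (hαβ : α < β) (x : ℝ) :
    β * Real.exp (α * x) ≤ (β - α) + α * Real.exp (β * x) := by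
  have hβ : 0 < β := hα.trans hαβ
  have h := convexOn_exp.2 (Set.mem_univ 0) (Set.mem_univ (β * x))
    (show 0 ≤ 1 - α / β by rw [sub_nonneg, div_le_one hβ]; exact hαβ.le)
    (show 0 ≤ α / β by positivity) (by ring)
  simp only [smul_eq_mul, mul_zero, zero_add, Real.exp_zero, mul_one] at h
  rw [show α / β * (β * x) = α * x by field_simp] at h
  calc β * Real.exp (α * x) ≤ β * (1 - α / β + α / β * Real.exp (β * x)) :=
        mul_le_mul_of_nonneg_left h hβ.le
    _ = _ := by field_simp

theorem peak_density_nonneg {a b c : ℝ} (ha : a < 0) (hb : b < 0) (hab : a ≠ b) (hc : a + b = -c)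
    (x : ℝ) :
    0 ≤ c * (Real.exp (-c * x) + (b * Real.exp (b * x) - a * Real.exp (a * x)) / (a - b)) := by
  have hc0 : 0 < c := by linarith
  have key : ∀ a b : ℝ, a < 0 → b < a → a + b = -c →
      0 ≤ Real.exp (-c * x) + (b * Real.exp (b * x) - a * Real.exp (a * x)) / (a - b) := by
    intro a b ha hba hc
    have h := exp_mul_le_of_convex (neg_pos.2 ha) (neg_lt_neg hba) x
    have e1 : Real.exp (b * x) = Real.exp (-c * x) * Real.exp (-a * x) := by
      rw [← Real.exp_add, ← hc]; ring_nf
    have e2 : Real.exp (a * x) = Real.exp (-c * x) * Real.exp (-b * x) := by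
      rw [← Real.exp_add, ← hc]; ring_nf
    have hd : 0 < a - b := sub_pos.2 hba
    have : Real.exp (-c * x) + (b * Real.exp (b * x) - a * Real.exp (a * x)) / (a - b) =
        Real.exp (-c * x) * ((a - b + b * Real.exp (-a * x) - a * Real.exp (-b * x)) / (a - b)) := by
      rw [e1, e2]; field_simp; ring
    rw [this]
    exact mul_nonneg (Real.exp_pos _).le (div_nonneg (by linarith) hd.le)
  refine mul_nonneg hc0.le ?_
  rcases lt_or_gt_of_ne hab with h | h
  · have := key b a hb h (by linarith)
    have e : (b * Real.exp (b * x) - a * Real.exp (a * x)) / (a - b) =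
        (a * Real.exp (a * x) - b * Real.exp (b * x)) / (b - a) := by
      rw [← neg_sub a b, div_neg, ← neg_div, neg_sub]
    rwa [e]
  · exact key a b ha h hc

theorem integral_peak_density {a b c : ℝ} (ha : a < 0) (hb : b < 0) (hab : a ≠ b) (hc : 0 < c)
    (p : ℝ) :
    ∫ x in Set.Ioi p, c * (Real.exp (-c * x) +
        (b * Real.exp (b * x) - a * Real.exp (a * x)) / (a - b)) =
      Real.exp (-c * p) + c / (a - b) * (Real.exp (a * p) - Real.exp (b * p)) := by
  have hia := integrableOn_exp_mul_Ioi ha p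
  have hib := integrableOn_exp_mul_Ioi hb p
  have hic := integrableOn_exp_mul_Ioi (neg_lt_zero.2 hc) p
  have hd : IntegrableOn (fun x => (b * Real.exp (b * x) - a * Real.exp (a * x)) / (a - b))
      (Set.Ioi p) := ((hib.const_mul b).sub (hia.const_mul a)).div_const _
  rw [integral_const_mul, integral_add hic hd,
    integral_div, integral_sub (hib.const_mul b) (hia.const_mul a), integral_const_mul,
    integral_const_mul, integral_exp_mul_Ioi ha, integral_exp_mul_Ioi hb,
    integral_exp_mul_Ioi (neg_lt_zero.2 hc)]
  have hd : a - b ≠ 0 := sub_ne_zero.2 hab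
  have ha' := ha.ne
  have hb' := hb.ne
  have hc' := hc.ne'
  field_simp
  ring

theorem integral_interDeparture_density {a b K : ℝ} (ha : a < 0) (hb : b < 0) (hab : a ≠ b)
    (t : ℝ) :
    ∫ x in Set.Ioi (0 : ℝ), ((K / (a - b) * (Real.exp (a * x) - Real.exp (b * x)) : ℝ) : ℂ) *
        Complex.exp (t * x * Complex.I) =
      K / ((a + t * Complex.I) * (b + t * Complex.I)) := by
  obtain ⟨hia, ea⟩ := integral_Ioi_exp_mul_cexp ha t
  obtain ⟨hib, eb⟩ := integral_Ioi_exp_mul_cexp hb t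
  have h : ∀ x : ℝ, ((K / (a - b) * (Real.exp (a * x) - Real.exp (b * x)) : ℝ) : ℂ) *
        Complex.exp (t * x * Complex.I) =
      ((K / (a - b) : ℝ) : ℂ) * ((Real.exp (a * x) : ℂ) * Complex.exp (t * x * Complex.I) -
        (Real.exp (b * x) : ℂ) * Complex.exp (t * x * Complex.I)) := fun x => by
    push_cast; ring
  simp_rw [h]
  rw [integral_const_mul, integral_sub hia hib, ea, eb]
  have na := add_mul_I_ne_zero ha t
  have nb := add_mul_I_ne_zero hb t
  have nd : (a : ℂ) - b ≠ 0 := sub_ne_zero.2 (by exact_mod_cast hab)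
  push_cast
  field_simp
  ring

theorem integral_peak_density_cexp {a b c : ℝ} (ha : a < 0) (hb : b < 0) (hab : a ≠ b)
    (hc : a + b = -c) (t : ℝ) :
    ∫ x in Set.Ioi (0 : ℝ), ((c * (Real.exp (-c * x) +
        (b * Real.exp (b * x) - a * Real.exp (a * x)) / (a - b)) : ℝ) : ℂ) *
        Complex.exp (t * x * Complex.I) =
      c * (a * b) / ((c - t * Complex.I) * ((a + t * Complex.I) * (b + t * Complex.I))) := by
  have hc0 : -c < 0 := by linarith
  obtain ⟨hia, ea⟩ := integral_Ioi_exp_mul_cexp ha t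
  obtain ⟨hib, eb⟩ := integral_Ioi_exp_mul_cexp hb t
  obtain ⟨hic, ec⟩ := integral_Ioi_exp_mul_cexp hc0 t
  have h : ∀ x : ℝ, ((c * (Real.exp (-c * x) +
        (b * Real.exp (b * x) - a * Real.exp (a * x)) / (a - b)) : ℝ) : ℂ) *
        Complex.exp (t * x * Complex.I) =
      (c : ℂ) * ((Real.exp (-c * x) : ℂ) * Complex.exp (t * x * Complex.I)) +
      (((c * b / (a - b) : ℝ) : ℂ) * ((Real.exp (b * x) : ℂ) * Complex.exp (t * x * Complex.I)) -
       ((c * a / (a - b) : ℝ) : ℂ) * ((Real.exp (a * x) : ℂ) * Complex.exp (t * x * Complex.I))) :=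
    fun x => by push_cast; ring
  simp_rw [h]
  have hd : IntegrableOn (fun x : ℝ =>
      ((c * b / (a - b) : ℝ) : ℂ) * ((Real.exp (b * x) : ℂ) * Complex.exp (t * x * Complex.I)) -
      ((c * a / (a - b) : ℝ) : ℂ) * ((Real.exp (a * x) : ℂ) * Complex.exp (t * x * Complex.I)))
      (Set.Ioi 0) := (hib.const_mul _).sub (hia.const_mul _)
  rw [integral_add (hic.const_mul _) hd,
    integral_sub (hib.const_mul _) (hia.const_mul _), integral_const_mul, integral_const_mul,
    integral_const_mul, ea, eb, ec]
  have na := add_mul_I_ne_zero ha t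
  have nb := add_mul_I_ne_zero hb t
  have nc := add_mul_I_ne_zero hc0 t
  have nc' : (c : ℂ) - t * Complex.I ≠ 0 := fun h => nc (by push_cast; linear_combination -h)
  have nd : (a : ℂ) - b ≠ 0 := sub_ne_zero.2 (by exact_mod_cast hab)
  have hcc : (c : ℂ) = -(a + b) := by rw [← neg_eq_iff_eq_neg, eq_comm]; exact_mod_cast hc
  have e : (-c : ℝ) + t * Complex.I = -((c : ℂ) - t * Complex.I) := by push_cast; ring
  rw [e]
  push_cast
  field_simp
  rw [hcc]
  ring

/-! ### Back to the original probability space -/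

section transfer

variable {Ω : Type*} {N : ℕ}

/-- All primitives of the system, as a point of the canonical space. -/
def primitives (X S : Fin N → ℕ → Ω → ℝ) (ω : Ω) : Primitives N := fun q =>
  Sum.elim (fun q : Fin N × ℕ => X q.1 q.2) (fun q : Fin N × ℕ => S q.1 q.2) q ω

theorem systemTime_eq (X S : Fin N → ℕ → Ω → ℝ) (i : Fin N) (k : ℕ) :
    systemTime X S i k = systemTime interArrivalOf serviceOf i k ∘ primitives X S := rfl

theorem interDeparture_eq (X S : Fin N → ℕ → Ω → ℝ) (i : Fin N) (k : ℕ) :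
    interDeparture X S i k = interDeparture interArrivalOf serviceOf i k ∘ primitives X S := rfl

variable [MeasurableSpace Ω] {P : Measure Ω} {lam : Fin N → ℝ} {mu : ℝ} {X S : Fin N → ℕ → Ω → ℝ}

theorem measurePreserving_primitives (hsys : IsMM11 P lam mu X S) :
    MeasurePreserving (primitives X S) P (primitiveLaw lam mu) := by
  have hm : Measurable (primitives X S) := by
    refine measurable_pi_iff.2 ?_
    rintro (q | q)
    exacts [hsys.measurable_interArrival _ _, hsys.measurable_service _ _]
  refine ⟨hm, (hsys.indep.hasLaw_infinitePi (μ := marginal lam mu) ?_ hm.aemeasurable).map_eq⟩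
  rintro (q | q)
  exacts [hsys.law_interArrival _ _, hsys.law_service _ _]

theorem integral_cexp_system_interDeparture (hlam : ∀ j, 0 < lam j) (hmu : 0 < mu)
    (hsys : IsMM11 P lam mu X S) (i : Fin N) (k : ℕ) (u v : ℝ) :
    (∫ ω, Complex.exp (((u * systemTime X S i k ω + v * interDeparture X S i k ω : ℝ) : ℂ) *
        Complex.I) ∂P) * ((∑ j, lam j + mu - u * Complex.I) *
        (lam i * mu - v * Complex.I * (∑ j, lam j + mu - v * Complex.I))) =
      (∑ j, lam j + mu) * (lam i * mu) := by
  have h := integral_system_interDeparture hlam hmu i k u v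
  have hp := measurePreserving_primitives hsys
  rw [← hp.map_eq, integral_map hp.measurable.aemeasurable
    (hasFrequency_system_interDeparture i k u v).measurable.aestronglyMeasurable] at h
  exact h

theorem measurable_interDeparture_of_isMM11 (hsys : IsMM11 P lam mu X S) (i : Fin N) (k : ℕ) :
    Measurable (interDeparture X S i k) := by
  rw [interDeparture_eq]
  exact (measurable_interDeparture i k).comp (measurePreserving_primitives hsys).measurable

theorem measurable_peakAge_of_isMM11 (hsys : IsMM11 P lam mu X S) (i : Fin N) (k : ℕ) :
    Measurable (peakAge X S i k) := by
  refine (measurable_interDeparture_of_isMM11 hsys i k).add ?_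
  rw [systemTime_eq]
  exact (measurable_systemTime i k).comp (measurePreserving_primitives hsys).measurable

variable {a b : ℝ} {i : Fin N}

/-- Vieta's formulas for the two roots, and their signs. -/
theorem roots_spec {c K : ℝ} (hc : 0 < c) (hK : 0 < K) (ha : a ^ 2 + c * a + K = 0)
    (hb : b ^ 2 + c * b + K = 0) (hab : a ≠ b) : a + b = -c ∧ a * b = K ∧ a < 0 ∧ b < 0 := by
  have h1 : a + b = -c := by
    have : (a - b) * (a + b + c) = 0 := by linear_combination ha - hb
    rcases mul_eq_zero.1 this with h | h
    · exact absurd (sub_eq_zero.1 h) hab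
    · linarith
  refine ⟨h1, ?_, ?_, ?_⟩
  · have : b = -c - a := by linarith
    rw [this]; linear_combination -ha
  · by_contra h
    have := mul_nonneg hc.le (not_lt.1 h)
    nlinarith [sq_nonneg a]
  · by_contra h
    have := mul_nonneg hc.le (not_lt.1 h)
    nlinarith [sq_nonneg b]

theorem isDensityOf_interDeparture [IsProbabilityMeasure P] (hlam : ∀ j, 0 < lam j) (hmu : 0 < mu)
    (hsys : IsMM11 P lam mu X S)
    (ha : a ^ 2 + ((∑ j, lam j) + mu) * a + lam i * mu = 0)
    (hb : b ^ 2 + ((∑ j, lam j) + mu) * b + lam i * mu = 0) (hab : a ≠ b) (k : ℕ) :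
    IsDensityOf P (interDeparture X S i k) (fun x =>
      if 0 ≤ x then lam i * mu / (a - b) * (Real.exp (a * x) - Real.exp (b * x)) else 0) := by
  have hc : 0 < ∑ j, lam j + mu :=
    add_pos (Finset.sum_pos (fun j _ => hlam j) ⟨i, Finset.mem_univ i⟩) hmu
  have hK : 0 < lam i * mu := mul_pos (hlam i) hmu
  obtain ⟨hs, hp, ha0, hb0⟩ := roots_spec hc hK ha hb hab
  refine isDensityOf_of_charFun (measurable_interDeparture_of_isMM11 hsys i k) (by fun_prop)
    (fun x hx => ?_) ?_ fun t => ?_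
  · rw [div_mul_eq_mul_div, mul_div_assoc]
    exact mul_nonneg hK.le (exp_density_nonneg hab hx)
  · exact ((integrableOn_exp_mul_Ioi ha0 0).sub (integrableOn_exp_mul_Ioi hb0 0)).const_mul _
  · rw [integral_interDeparture_density ha0 hb0 hab]
    have h := integral_cexp_system_interDeparture hlam hmu hsys i k 0 t
    simp only [zero_mul, zero_add, Complex.ofReal_zero, sub_zero, Complex.ofReal_mul] at h
    have na := add_mul_I_ne_zero ha0 t
    have nb := add_mul_I_ne_zero hb0 t
    have hsc : ((∑ j, lam j : ℝ) : ℂ) + mu = -(a + b) := by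
      have : (∑ j, lam j) + mu = -(a + b) := by linarith
      exact_mod_cast this
    have hpc : (lam i : ℂ) * mu = a * b := by exact_mod_cast hp.symm
    have hsn : -((a : ℂ) + b) ≠ 0 := by rw [← hsc]; exact_mod_cast hc.ne'
    rw [hsc, hpc, mul_left_comm] at h
    rw [eq_div_iff (mul_ne_zero na nb)]
    push_cast
    rw [hpc, ← mul_left_cancel₀ hsn h]
    congr 1
    ring

theorem isDensityOf_peakAge [IsProbabilityMeasure P] (hlam : ∀ j, 0 < lam j) (hmu : 0 < mu)
    (hsys : IsMM11 P lam mu X S)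
    (ha : a ^ 2 + ((∑ j, lam j) + mu) * a + lam i * mu = 0)
    (hb : b ^ 2 + ((∑ j, lam j) + mu) * b + lam i * mu = 0) (hab : a ≠ b) (k : ℕ) :
    IsDensityOf P (peakAge X S i k) (fun x =>
      if 0 ≤ x then ((∑ j, lam j) + mu) * (Real.exp (-((∑ j, lam j) + mu) * x) +
        (b * Real.exp (b * x) - a * Real.exp (a * x)) / (a - b)) else 0) := by
  have hc : 0 < ∑ j, lam j + mu :=
    add_pos (Finset.sum_pos (fun j _ => hlam j) ⟨i, Finset.mem_univ i⟩) hmu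
  have hK : 0 < lam i * mu := mul_pos (hlam i) hmu
  obtain ⟨hs, hp, ha0, hb0⟩ := roots_spec hc hK ha hb hab
  refine isDensityOf_of_charFun (measurable_peakAge_of_isMM11 hsys i k) (by fun_prop)
    (fun x _ => peak_density_nonneg ha0 hb0 hab hs x) ?_ fun t => ?_
  · exact ((integrableOn_exp_mul_Ioi (neg_lt_zero.2 hc) 0).add
      ((((integrableOn_exp_mul_Ioi hb0 0).const_mul b).sub
        ((integrableOn_exp_mul_Ioi ha0 0).const_mul a)).div_const _)).const_mul _
  · rw [integral_peak_density_cexp ha0 hb0 hab hs]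
    have h := integral_cexp_system_interDeparture hlam hmu hsys i k t t
    have na := add_mul_I_ne_zero ha0 t
    have nb := add_mul_I_ne_zero hb0 t
    have nc := rate_sub_ne_zero hlam hmu t
    have hsc : ((∑ j, lam j : ℝ) : ℂ) + mu = -(a + b) := by
      have : (∑ j, lam j) + mu = -(a + b) := by linarith
      exact_mod_cast this
    have hpc : (lam i : ℂ) * mu = a * b := by exact_mod_cast hp.symm
    have he : ∀ ω, ((t * systemTime X S i k ω + t * interDeparture X S i k ω : ℝ) : ℂ) =
        t * peakAge X S i k ω := fun ω => by rw [peakAge]; push_cast; ring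
    simp_rw [he] at h
    rw [Complex.ofReal_add, hsc, eq_div_iff
      (mul_ne_zero (by rw [← hsc]; exact nc) (mul_ne_zero na nb))]
    rw [hsc, hpc] at h
    rw [← h]
    congr 2
    ring

/-- Tail probabilities from a density on the half-line. -/
theorem measureReal_lt_of_isDensityOf {Z : Ω → ℝ} {g : ℝ → ℝ}
    (h : IsDensityOf P Z (fun x => if 0 ≤ x then g x else 0)) {p : ℝ} (hp : 0 < p) :
    P.real {ω | p < Z ω} = ∫ x in Set.Ioi p, g x := by
  obtain ⟨hm, hn, hZ⟩ := h
  have h1 : ∫ x in Set.Ioi p, g x = ∫ x in Set.Ioi p, if 0 ≤ x then g x else 0 :=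
    setIntegral_congr_fun measurableSet_Ioi fun x hx => (if_pos (hp.trans hx).le).symm
  rw [hZ.measureReal_eq (p := fun x => p < x) measurableSet_Ioi, h1,
    integral_eq_lintegral_of_nonneg_ae (.of_forall hn) hm.aestronglyMeasurable, Measure.real]
  congr 1
  exact withDensity_apply _ measurableSet_Ioi

end transfer

end PreemptiveQueue

theorem mainTheorem3 {Ω : Type*} [MeasurableSpace Ω] (P : Measure Ω) [IsProbabilityMeasure P]
    {N : ℕ} (lam : Fin N → ℝ) (hlam : ∀ j, 0 < lam j) (mu : ℝ) (hmu : 0 < mu)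
    (X S : Fin N → ℕ → Ω → ℝ) (hsys : PreemptiveQueue.IsMM11 P lam mu X S)
    (i : Fin N) (a b : ℝ)
    (ha : a ^ 2 + ((∑ j, lam j) + mu) * a + lam i * mu = 0)
    (hb : b ^ 2 + ((∑ j, lam j) + mu) * b + lam i * mu = 0)
    (hab : a ≠ b) :
    (∀ᵐ ω ∂P, {n : ℕ | PreemptiveQueue.Received X S i n ω}.Infinite) ∧
    ∀ k : ℕ,
      (∀ p : ℝ, 0 < p →
        PreemptiveQueue.peakAgeViolation P X S i k p =
          Real.exp (-((∑ j, lam j) + mu) * p) +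
            ((∑ j, lam j) + mu) / (a - b) * (Real.exp (a * p) - Real.exp (b * p))) ∧
      PreemptiveQueue.IsDensityOf P (PreemptiveQueue.peakAge X S i k) (fun x =>
        if 0 ≤ x then
          ((∑ j, lam j) + mu) * (Real.exp (-((∑ j, lam j) + mu) * x) +
            (b * Real.exp (b * x) - a * Real.exp (a * x)) / (a - b))
        else 0) ∧
      PreemptiveQueue.IsDensityOf P (PreemptiveQueue.interDeparture X S i k) (fun x =>
        if 0 ≤ x then
          lam i * mu / (a - b) * (Real.exp (a * x) - Real.exp (b * x))
        else 0) := by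
  have hc : 0 < ∑ j, lam j + mu :=
    add_pos (Finset.sum_pos (fun j _ => hlam j) ⟨i, Finset.mem_univ i⟩) hmu
  obtain ⟨-, -, ha0, hb0⟩ :=
    PreemptiveQueue.roots_spec hc (mul_pos (hlam i) hmu) ha hb hab
  refine ⟨?_, fun k => ⟨fun p hp => ?_, ?_, ?_⟩⟩
  · exact (PreemptiveQueue.measurePreserving_primitives hsys).quasiMeasurePreserving.ae
      (PreemptiveQueue.ae_infinite_received hlam hmu i)
  · rw [PreemptiveQueue.peakAgeViolation, PreemptiveQueue.measureReal_lt_of_isDensityOf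
      (PreemptiveQueue.isDensityOf_peakAge hlam hmu hsys ha hb hab k) hp,
      PreemptiveQueue.integral_peak_density ha0 hb0 hab hc]
  · exact PreemptiveQueue.isDensityOf_peakAge hlam hmu hsys ha hb hab k
  · exact PreemptiveQueue.isDensityOf_interDeparture hlam hmu hsys ha hb hab k
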